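/- Let $\mathcal H\neq\{0\}$ be a real separable Hilbert space (finite- or countably infinite-dimensional) and let $\mathcal D$ be a probability distribution of pairs $(x,y)\in\mathcal H\times\mathbb R$. Let $L(w)=\frac12\mathbb E_{(x,y)\sim\mathcal D}[(y-\langle w,x\rangle)^2]$ and $H=\mathbb E[xx^\top]$. Assume: 1. (Regularity) $\mathbb E\|x\|^2=\operatorname{tr}(H)$, $\mathbb E\|x\|^4$ and $\mathbb E[y^2]$ are finite, $H$ is strictly positive definite, and $L$ has a unique global minimizer $w^*$. 2. (Well-specified model) $y=\langle w^*,x\rangle+\epsilon$, where $\epsilon\sim\mathcal N(0,\sigma^2_{\mathrm{noise}})$ is independent of $x$ (and $\sigma^2_{\mathrm{noise}}\ge 0$). 3. (Fourth moment, upper bound) There is $\alpha>0$ such that $\mathbb E[xx^\top A\,xx^\top]\preceq\alpha\operatorname{tr}(HA)H$ for every bounded positive semidefinite operator $A$ on $\mathcal H$. 4. (Fourth moment, lower bound) $\beta\ge0$ is such that $\mathbb E[xx^\top A\,xx^\top]-HAH\succeq\beta\operatorname{tr}(HA)H$ for every bounded positive semidefinite operator $A$ on $\mathcal H$. Let $H=\sum_i\lambda_iv_iv_i^\top$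 be an eigendecomposition with $(v_i)_{i\ge1}$ an orthonormal basis of $\mathcal H$ and $\lambda_1\ge\lambda_2\ge\cdots$ (with $\lambda_i=0$ for $i>\dim\mathcal H$ if $\dim\mathcal H<\infty$), and put $$\|w\|_H^2=\langle w,Hw\rangle,\qquad \|w\|^2_{H_{0:k}^{-1}}=\sum_{i\le k}\frac{\langle v_i,w\rangle^2}{\lambda_i},\qquad \|w\|^2_{H_{k:\infty}}=\sum_{i>k}\lambda_i\langle v_i,w\rangle^2 .$$ Let $(x_t,y_t)_{t\ge1}$ be independent with law $\mathcal D$, let $w_0\in\mathcal H$ be deterministic, let $0<\gamma<1/\lambda_1$, and let SGD be run as $w_t=w_{t-1}+\gamma\,(y_t-\langle w_{t-1},x_t\rangle)\,x_t$. For integers $s\ge0$ and $N\ge500$ let $$\overline w_{s:s+N}=\frac1N\sum_{t=s}^{s+N-1}w_t$$ be the tail average. Then $\mathbb E[L(\overline w_{s:s+N})]$ is finite and $$\begin{aligned} \mathbb E[L(\overline w_{s:s+N})]-L(w^*)\ \ge\ &\frac{1}{16\gamma^2N^2}\,\big\|(I-\gamma H)^s(w_0-w^*)\big\|^2_{H_{0:k^*}^{-1}}+\frac1{16}\,\big\|(I-\gamma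 H)^s(w_0-w^*)\big\|^2_{H_{k^*:\infty}}\\ &+\frac{\beta\gamma\,\|w_0-w^*\|_H^2}{128e^3}\cdot\min\Big\{\frac1{\lambda_1},(2s+N)\gamma\Big\}\cdot\sum_{i>k^\dagger}\lambda_i^2\\ &+\frac{\sigma^2_{\mathrm{noise}}}{600}\Big(\frac{k^*}{N}+\gamma\sum_{k^*<i\le k^\dagger}\lambda_i+(s+N)\gamma^2\sum_{i>k^\dagger}\lambda_i^2\Big), \end{aligned}$$ where $k^*=\max\{k\ge1:\lambda_k\ge\frac1{N\gamma}\}$ and $k^\dagger=\max\{k\ge1:\lambda_k\ge\frac1{(s+N)\gamma}\}$, the maximum of the empty set being $0$. -/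

import Mathlib

open MeasureTheory ProbabilityTheory InnerProductSpace
open scoped NNReal

noncomputable section

namespace TailSGD

section Operators

variable {E : Type*} [NormedAddCommGroup E] [InnerProductSpace ℝ E] [CompleteSpace E]

/-- The trace `∑ i, ⟪b i, T (b i)⟫` of a trace-class operator on a Hilbert space, computed in
some orthonormal (Hilbert) basis `b`; for trace-class `T` the value does not depend on `b`. -/
def opTrace (T : E →L[ℝ] E) : ℝ :=
  ∑' i : (exists_hilbertBasis ℝ E).choose,
    inner ℝ ((exists_hilbertBasis ℝ E).choose_spec.choose i)
      (T ((exists_hilbertBasis ℝ E).choose_spec.choose i))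

/-- A sorted eigendecomposition `T = ∑ i, lam i • v i ⊗ v i` of an operator: a Hilbert basis
`v 1, v 2, …` of eigenvectors, with eigenvalues `lam 1 ≥ lam 2 ≥ …` (repeated according to
multiplicity). The space may be finite-dimensional (`dim` finite) or not (`dim = ⊤`); in the first
case the list of eigenvalues is continued by zeros. Indices start at `1`, and `lam 0` is not
used. -/
structure SortedEigendecomposition (T : E →L[ℝ] E) where
  /-- the number of basis vectors -/
  dim : ℕ∞
  /-- the eigenvectors -/
  v : HilbertBasis {i : ℕ // 1 ≤ i ∧ (i : ℕ∞) ≤ dim} ℝ E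
  /-- the eigenvalues -/
  lam : ℕ → ℝ
  apply_v : ∀ i, T (v i) = lam i • v i
  lam_anti : ∀ i j, 1 ≤ i → i ≤ j → lam j ≤ lam i
  lam_eq_zero : ∀ i : ℕ, dim < (i : ℕ∞) → lam i = 0

namespace SortedEigendecomposition

variable {T : E →L[ℝ] E} (e : SortedEigendecomposition T)

/-- `max {k ≥ 1 : lam k ≥ θ}`, and `0` if there is no such `k`. -/
def cutoff (θ : ℝ) : ℕ := sSup {k : ℕ | 1 ≤ k ∧ θ ≤ e.lam k}

/-- `‖w‖²` in the pseudo-inverse of the head `T_{0:k}`: the sum of `⟪v i, w⟫² / lam i`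
over `i ≤ k`. -/
def headInvNormSq (k : ℕ) (w : E) : ℝ :=
  ∑' i : {i : ℕ // 1 ≤ i ∧ (i : ℕ∞) ≤ e.dim},
    if (i : ℕ) ≤ k then (inner ℝ (e.v i) w) ^ 2 / e.lam i else 0

/-- `‖w‖²` in the tail `T_{k:∞}`: the sum of `lam i * ⟪v i, w⟫²` over `i > k`. -/
def tailNormSq (k : ℕ) (w : E) : ℝ :=
  ∑' i : {i : ℕ // 1 ≤ i ∧ (i : ℕ∞) ≤ e.dim},
    if k < (i : ℕ) then e.lam i * (inner ℝ (e.v i) w) ^ 2 else 0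

/-- The sum of `(lam i) ^ 2` over `i > k`. -/
def tailSumSq (k : ℕ) : ℝ := ∑' i : ℕ, if k < i then e.lam i ^ 2 else 0

end SortedEigendecomposition

end Operators

section Model

variable {E : Type*} [NormedAddCommGroup E] [InnerProductSpace ℝ E] [CompleteSpace E]
  [MeasurableSpace E]

/-- The population risk `L(w) = ½ 𝔼 (y - ⟪w, x⟫)²` of a distribution `D` of pairs `(x, y)`. -/
def risk (D : Measure (E × ℝ)) (w : E) : ℝ :=
  1 / 2 * ∫ z, (z.2 - inner ℝ w z.1) ^ 2 ∂D

/-- The second moment operator `H = 𝔼[x xᵀ]` of the feature vector. -/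
def secondMoment (D : Measure (E × ℝ)) : E →L[ℝ] E :=
  ∫ z, rankOne ℝ z.1 z.1 ∂D

/-- The operator `𝔼[x xᵀ A x xᵀ]`. -/
def fourthMoment (D : Measure (E × ℝ)) (A : E →L[ℝ] E) : E →L[ℝ] E :=
  ∫ z, rankOne ℝ z.1 z.1 ∘L A ∘L rankOne ℝ z.1 z.1 ∂D

/-- Regularity conditions: finite second and fourth moments of `x` and finite second moment of `y`
(the trace of `H = 𝔼[x xᵀ]` is `𝔼 ‖x‖²`), `H` strictly positive definite, and `wstar` is the
unique minimizer of the risk. -/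
structure RegularMoments (D : Measure (E × ℝ)) (wstar : E) : Prop where
  integrable_x_sq : Integrable (fun z : E × ℝ => ‖z.1‖ ^ 2) D
  integrable_x_four : Integrable (fun z : E × ℝ => ‖z.1‖ ^ 4) D
  integrable_y_sq : Integrable (fun z : E × ℝ => z.2 ^ 2) D
  pos_def : ∀ w : E, w ≠ 0 → 0 < inner ℝ w (secondMoment D w)
  unique_min : ∀ w : E, w ≠ wstar → risk D wstar < risk D w

/-- Upper fourth moment condition: `𝔼[x xᵀ A x xᵀ] ≤ α tr(H A) H` in the Loewner order, for all
positive semidefinite `A`. -/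
def FourthMomentUpper (D : Measure (E × ℝ)) (α : ℝ) : Prop :=
  0 < α ∧ ∀ A : E →L[ℝ] E, A.IsPositive →
    fourthMoment D A ≤ (α * opTrace (secondMoment D ∘L A)) • secondMoment D

/-- Lower fourth moment condition: `𝔼[x xᵀ A x xᵀ] - H A H ≥ β tr(H A) H` in the Loewner order,
for all positive semidefinite `A`. -/
def FourthMomentLower (D : Measure (E × ℝ)) (β : ℝ) : Prop :=
  0 ≤ β ∧ ∀ A : E →L[ℝ] E, A.IsPositive →
    (β * opTrace (secondMoment D ∘L A)) • secondMoment D ≤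
      fourthMoment D A - secondMoment D ∘L A ∘L secondMoment D

/-- Well-specified model: `y = ⟪wstar, x⟫ + ε` with `ε ∼ 𝒩(0, σsq)` independent of `x`. -/
structure WellSpecified (D : Measure (E × ℝ)) (wstar : E) (σsq : ℝ≥0) : Prop where
  indep : IndepFun (fun z : E × ℝ => z.1) (fun z : E × ℝ => z.2 - inner ℝ wstar z.1) D
  noise_law : D.map (fun z : E × ℝ => z.2 - inner ℝ wstar z.1) = gaussianReal 0 σsq

/-- The random examples `z 0, z 1, …` are independent with common law `D`. -/
structure IsIIDSample {Ω : Type*} [MeasurableSpace Ω] (P : Measure Ω) (D : Measure (E × ℝ))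
    (z : ℕ → Ω → E × ℝ) : Prop where
  measurable : ∀ t, Measurable (z t)
  indep : iIndepFun z P
  law : ∀ t, P.map (z t) = D

end Model

section Algorithm

variable {E : Type*} [NormedAddCommGroup E] [InnerProductSpace ℝ E]

/-- The iterates of stochastic gradient descent with constant stepsize `γ` started at `w0`, run on
a sequence of examples; `z t` is the example `(x, y)` used in the step from iterate `t` to iterate
`t + 1`. -/
def sgd (γ : ℝ) (w0 : E) (z : ℕ → E × ℝ) : ℕ → E
  | 0 => w0
  | t + 1 => sgd γ w0 z t + (γ * ((z t).2 - inner ℝ (sgd γ w0 z t) (z t).1)) • (z t).1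

/-- The average of the `N` iterates with indices `s, s + 1, …, s + N - 1`. -/
def tailAverage (γ : ℝ) (w0 : E) (s N : ℕ) (z : ℕ → E × ℝ) : E :=
  (N : ℝ)⁻¹ • ∑ t ∈ Finset.Ico s (s + N), sgd γ w0 z t

end Algorithm

end TailSGD

end

set_option linter.unusedSectionVars false

namespace TailSGD

/-! Write `g_t = w_t - w*`. Since the noise is centred and independent of `x`, the excess risk at
`w` is half of `⟨w - w*, H (w - w*)⟩`, so in the eigenbasis the claim splits into scalar problems:
bound `½ λ_i E⟨v_i, w̄ - w*⟩²` from below for each `i`, and add up.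

Fix an eigenvector `v` with eigenvalue `λ` and put `a_t = E⟨v, g_t⟩²`. One step multiplies the
conditional mean of `⟨v, g⟩` by `1 - γλ`, so `E⟨v, g_t⟩⟨v, g_k⟩ = (1 - γλ)^(k-t) a_t` for `t ≤ k`
(`integral_inner_sgd_mul`). These correlations are nonnegative, so in the square of the average the
pairs with `k < t` may be dropped (`integral_inner_tailAverage_sq_ge`).

The lower fourth moment condition, used only for the rank-one operators `A = g gᵀ`, gives `a_{t+1} ≥
(1 - γλ)² a_t + γ²λ (β E‖g_t‖_H² + σ²)` (`integral_inner_sgd_succ_sq_ge`). A first, crude use of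
this recursion yields `E‖g_t‖_H² ≥ (1 - γλ₁)^(2t) ‖w₀ - w*‖_H²` (`integral_quadratic_sgd_ge`).
Feeding that back and unrolling bounds `a_t` below by three contributions: the contracted initial
error, the gradient noise caused by `β`, and the label noise. `coordinate_lower` sums each over the
window; comparing `λ` with `1/(Nγ)` and `1/((s+N)γ)` produces `k*` and `k†`. -/

/-! ### Scalar inequalities for geometric weights -/

theorem half_min_one_mul_le_one_sub_pow {x : ℝ} (hx0 : 0 ≤ x) (hx1 : x ≤ 1) (n : ℕ) :
    min 1 (n * x) / 2 ≤ 1 - (1 - x) ^ n := by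
  -- Bernoulli for `(1 + x)^n`, then `(1 - x)(1 + x) ≤ 1`; hence `1 - (1 - x)^n ≥ nx / (1 + nx)`.
  have h1 : (1 - x) ^ n * (1 + n * x) ≤ 1 := by
    calc (1 - x) ^ n * (1 + n * x) ≤ (1 - x) ^ n * (1 + x) ^ n := by
          refine mul_le_mul_of_nonneg_left ?_ (pow_nonneg (by linarith) n)
          exact one_add_mul_le_pow (by linarith) n
      _ = (1 - x ^ 2) ^ n := by rw [← mul_pow]; ring
      _ ≤ 1 := pow_le_one₀ (by nlinarith) (by nlinarith)
  have h2 : 0 ≤ (1 - x) ^ n := pow_nonneg (by linarith) n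
  have h3 : 0 ≤ n * x := by positivity
  generalize (1 - x) ^ n = p at *
  generalize n * x = m at *
  rcases le_total 1 m with h | h
  · rw [min_eq_left h]; nlinarith
  · rw [min_eq_right h]
    by_contra! hc
    nlinarith [mul_nonneg h3 (sub_nonneg.2 h)]

/-- With `p = r^N` the geometric sums evaluate exactly: `(1 + r)(1 - r)` times the sum is `r^(2s) (1
- p)(1 - pr)`. Then `pr ≤ p` and `1 + r ≤ 2`. This is the initial-error part of the tail average. -/
theorem sq_one_sub_pow_le_sum {r : ℝ} (h0 : 0 ≤ r) (h1 : r ≤ 1) (s N : ℕ) :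
    r ^ (2 * s) * (1 - r ^ N) ^ 2 ≤
      2 * (1 - r) * ∑ t ∈ Finset.Ico s (s + N), (1 - r ^ (s + N - t)) * r ^ (2 * t) := by
  have hS : ∑ t ∈ Finset.Ico s (s + N), (1 - r ^ (s + N - t)) * r ^ (2 * t) =
      r ^ (2 * s) * (∑ j ∈ Finset.range N, (r ^ 2) ^ j - r ^ N * ∑ j ∈ Finset.range N, r ^ j) := by
    rw [Finset.sum_Ico_eq_sum_range, Nat.add_sub_cancel_left, Finset.mul_sum,
      ← Finset.sum_sub_distrib, Finset.mul_sum]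
    refine Finset.sum_congr rfl fun j hj => ?_
    have hj' := Finset.mem_range.1 hj
    obtain ⟨m, rfl⟩ := Nat.exists_eq_add_of_lt hj'
    have : s + (j + m + 1) - (s + j) = m + 1 := by omega
    rw [this]
    ring
  have g1 := geom_sum_mul_neg r N
  have g2 := geom_sum_mul_neg (r ^ 2) N
  have hp0 : 0 ≤ r ^ N := pow_nonneg h0 N
  have hp1 : r ^ N ≤ 1 := pow_le_one₀ h0 h1
  have hs : 0 ≤ r ^ (2 * s) := pow_nonneg h0 _
  rw [hS]
  have hpp : (r ^ 2) ^ N = r ^ N * r ^ N := by rw [← pow_mul, two_mul, pow_add]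
  rw [hpp] at g2
  generalize hA : ∑ j ∈ Finset.range N, (r ^ 2) ^ j = A at *
  generalize hB : ∑ j ∈ Finset.range N, r ^ j = B at *
  generalize r ^ N = p at *
  have e1 : (1 + r) * ((1 - r) * (A - p * B)) = (1 - p) * (1 - p * r) := by
    have : (1 + r) * ((1 - r) * (A - p * B)) =
      A * (1 - r ^ 2) - (1 + r) * p * (B * (1 - r)) := by ring
    rw [this, g1, g2]; ring
  have h4 : (1 - p) ^ 2 ≤ (1 - p) * (1 - p * r) := by
    have : 0 ≤ (1 - p) * (p * (1 - r)) :=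
      mul_nonneg (by linarith) (mul_nonneg hp0 (by linarith))
    nlinarith
  have h5 : 0 ≤ (1 - r) * (A - p * B) := by
    by_contra! hc
    nlinarith [sq_nonneg (1 - p)]
  have h6 : (1 - p) ^ 2 ≤ 2 * ((1 - r) * (A - p * B)) := by nlinarith
  calc r ^ (2 * s) * (1 - p) ^ 2 ≤ r ^ (2 * s) * (2 * ((1 - r) * (A - p * B))) := by gcongr
    _ = _ := by ring

theorem half_one_sub_pow_le_geom {x : ℝ} (hx1 : x ≤ 1) (t : ℕ) :
    (1 - (1 - x) ^ (2 * t)) / 2 ≤ x * ∑ j ∈ Finset.range t, (1 - x) ^ (2 * j) := by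
  have g := geom_sum_mul_neg ((1 - x) ^ 2) t
  simp only [← pow_mul] at g
  have hA : 0 ≤ ∑ j ∈ Finset.range t, (1 - x) ^ (2 * j) :=
    Finset.sum_nonneg fun j _ => pow_nonneg (by linarith) _
  nlinarith [mul_nonneg hA (sq_nonneg x)]

/-- Only the second half of the window is kept: there `2t ≥ 2s + N`, so the accumulated noise has
already reached its typical size, while the weights still add up to order `N²`. -/
theorem le_sum_Ico_of_half {f : ℕ → ℝ} {s N : ℕ} {c : ℝ}
    (hf : ∀ t ∈ Finset.Ico s (s + N), 0 ≤ f t) (hc : 0 ≤ c)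
    (h : ∀ t ∈ Finset.Ico s (s + N), 2 * s + N ≤ 2 * t → c * ((s + N : ℝ) - t) ≤ f t) :
    c * ((N : ℝ) ^ 2 - 1) / 8 ≤ ∑ t ∈ Finset.Ico s (s + N), f t := by
  set n := N / 2 with hn
  set a := s + N - n with ha
  have han : a + n = s + N := by omega
  have hsub : Finset.Ico a (a + n) ⊆ Finset.Ico s (s + N) := by
    intro t ht
    simp only [Finset.mem_Ico] at *
    omega
  have hsum : ∑ t ∈ Finset.Ico a (a + n), ((s + N : ℝ) - t) = n * (n + 1) / 2 := by
    have e : (s + N : ℝ) = a + n := by exact_mod_cast han.symm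
    rw [Finset.sum_Ico_eq_sum_range, Nat.add_sub_cancel_left, e]
    have g : (∑ i ∈ Finset.range n, (i : ℝ)) * 2 = n * (n - 1) := by
      rcases Nat.eq_zero_or_pos n with h0 | h0
      · simp [h0]
      · have := Finset.sum_range_id_mul_two n
        have h2 : (((∑ i ∈ Finset.range n, i) * 2 : ℕ) : ℝ) = ((n * (n - 1) : ℕ) : ℝ) := by
          rw [this]
        push_cast [Nat.cast_sub h0] at h2
        exact h2
    simp only [Nat.cast_add, add_sub_add_left_eq_sub, Finset.sum_sub_distrib, Finset.sum_const,
      Finset.card_range, nsmul_eq_mul]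
    linarith
  calc c * ((N : ℝ) ^ 2 - 1) / 8 ≤ c * (n * (n + 1) / 2) := by
        -- The triangular sum is `n(n+1)/2 = ((2n+1)² - 1)/8`, whence the `N² - 1`; for odd `N`
        -- nothing is lost.
        have h1 : (N : ℝ) ≤ 2 * n + 1 := by
          have : N ≤ 2 * n + 1 := by omega
          exact_mod_cast this
        have h2 : (N : ℝ) ^ 2 ≤ (2 * n + 1) ^ 2 := by gcongr
        have : ((N : ℝ) ^ 2 - 1) / 8 ≤ n * (n + 1) / 2 := by nlinarith
        calc _ = c * (((N : ℝ) ^ 2 - 1) / 8) := by ring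
          _ ≤ _ := by gcongr
    _ = ∑ t ∈ Finset.Ico a (a + n), c * ((s + N : ℝ) - t) := by rw [← Finset.mul_sum, hsum]
    _ ≤ ∑ t ∈ Finset.Ico a (a + n), f t := by
        refine Finset.sum_le_sum fun t ht => h t (hsub ht) ?_
        have := (Finset.mem_Ico.1 ht).1
        omega
    _ ≤ _ := Finset.sum_le_sum_of_subset_of_nonneg hsub fun t ht _ => hf t ht

theorem le_of_linear_recursion {a c : ℕ → ℝ} {ρ : ℝ} (hρ : 0 ≤ ρ)
    (h : ∀ t, ρ * a t + c t ≤ a (t + 1)) (t : ℕ) :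
    ρ ^ t * a 0 + ∑ j ∈ Finset.range t, ρ ^ (t - 1 - j) * c j ≤ a t := by
  induction t with
  | zero => simp
  | succ t ih =>
    refine le_trans (le_of_eq ?_) ((add_le_add_left (mul_le_mul_of_nonneg_left ih hρ) _).trans (h t))
    rw [Finset.sum_range_succ, mul_add, Finset.mul_sum]
    have : ∑ j ∈ Finset.range t, ρ ^ (t + 1 - 1 - j) * c j =
        ∑ j ∈ Finset.range t, ρ * (ρ ^ (t - 1 - j) * c j) := by
      refine Finset.sum_congr rfl fun j hj => ?_
      have := Finset.mem_range.1 hj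
      have e : t + 1 - 1 - j = (t - 1 - j) + 1 := by omega
      rw [e, pow_succ]; ring
    rw [this]
    simp
    ring

theorem exp_neg_two_le_pow {x : ℝ} {n m : ℕ} (hn : 2 ≤ n) (hx0 : 0 ≤ x) (hx : n * x ≤ 1)
    (hm : m ≤ 2 * (n - 1)) : Real.exp (-2) ≤ (1 - x) ^ m := by
  have hn' : (2 : ℝ) ≤ n := by exact_mod_cast hn
  have hx1 : x < 1 := by nlinarith
  have hpos : 0 < 1 - x := by linarith
  -- Taking inverses, this is `1 + y ≤ exp y` at `y = x/(1-x)`. From `nx ≤ 1` one has `(n-1)x ≤ 1 -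
  -- x`, so an exponent up to `2(n-1)` costs at most `exp (-2)`.
  have h1 : Real.exp (-(x / (1 - x))) ≤ 1 - x := by
    rw [Real.exp_neg, inv_le_comm₀ (Real.exp_pos _) hpos]
    refine le_trans (le_of_eq ?_) (Real.add_one_le_exp _)
    field_simp
    ring
  have hmr : (m : ℝ) ≤ 2 * (n - 1) := by
    have : ((m : ℕ) : ℝ) ≤ ((2 * (n - 1) : ℕ) : ℝ) := by exact_mod_cast hm
    push_cast [Nat.cast_sub (by omega : 1 ≤ n)] at this
    exact this
  calc Real.exp (-2) ≤ Real.exp (m * (-(x / (1 - x)))) := by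
        apply Real.exp_le_exp.2
        have : m * (x / (1 - x)) ≤ 2 := by
          rw [← mul_div_assoc, div_le_iff₀ hpos]
          nlinarith
        linarith
    _ = Real.exp (-(x / (1 - x))) ^ m := Real.exp_nat_mul _ _
    _ ≤ (1 - x) ^ m := by gcongr

theorem weight_lower {x : ℝ} (hx0 : 0 ≤ x) (hx1 : x ≤ 1) {s N t : ℕ}
    (ht : t ∈ Finset.Ico s (s + N)) :
    0 ≤ 1 - (1 - x) ^ (s + N - t) ∧
      min 1 (((s + N : ℝ) - t) * x) / 2 ≤ 1 - (1 - x) ^ (s + N - t) := by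
  have ht' := Finset.mem_Ico.1 ht
  have h := half_min_one_mul_le_one_sub_pow hx0 hx1 (s + N - t)
  rw [Nat.cast_sub ht'.2.le] at h
  push_cast at h
  exact ⟨sub_nonneg.2 (pow_le_one₀ (by linarith) (by linarith)), h⟩

theorem noise_sum_lower {x : ℝ} (hx0 : 0 < x) (hx1 : x ≤ 1) (s N : ℕ) (hN : 0 < N) :
    min 1 (N * x) * min 1 ((s + N) * x) / (8 * N) * ((N : ℝ) ^ 2 - 1) / 8 ≤
      ∑ t ∈ Finset.Ico s (s + N), (1 - (1 - x) ^ (s + N - t)) *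
        (x * ∑ j ∈ Finset.range t, (1 - x) ^ (2 * j)) := by
  have hN' : (0 : ℝ) < N := by exact_mod_cast hN
  have hr : 0 ≤ 1 - x := by linarith
  have hA : ∀ t : ℕ, 0 ≤ x * ∑ j ∈ Finset.range t, (1 - x) ^ (2 * j) := fun t =>
    mul_nonneg hx0.le (Finset.sum_nonneg fun j _ => pow_nonneg hr _)
  have hm1 : 0 ≤ min 1 (N * x) := le_min zero_le_one (by positivity)
  have hm2 : 0 ≤ min 1 ((s + N) * x) := le_min zero_le_one (by positivity)
  refine le_sum_Ico_of_half (fun t ht => mul_nonneg (weight_lower hx0.le hx1 ht).1 (hA t))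
    (by positivity) fun t ht h2 => ?_
  have ht' := Finset.mem_Ico.1 ht
  have hd0 : (0 : ℝ) ≤ (s + N : ℝ) - t := by
    have : ((t : ℕ) : ℝ) ≤ ((s + N : ℕ) : ℝ) := by exact_mod_cast ht'.2.le
    push_cast at this; linarith
  have hdN : (s + N : ℝ) - t ≤ N := by
    have : (s : ℝ) ≤ t := by exact_mod_cast ht'.1
    linarith
  -- Concavity of `min 1 (· x)`, vanishing at `0`: shrinking the argument from `N` to `s + N - t`
  -- loses at most the ratio. The weight thus becomes linear in `s + N - t`.
  have h1 : ((s + N : ℝ) - t) / N * min 1 (N * x) / 2 ≤ 1 - (1 - x) ^ (s + N - t) := by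
    refine le_trans ?_ (weight_lower hx0.le hx1 ht).2
    gcongr
    refine le_min ?_ ?_
    · exact mul_le_one₀ ((div_le_one hN').2 hdN) hm1 (min_le_left _ _)
    · calc ((s + N : ℝ) - t) / N * min 1 (N * x) ≤ ((s + N : ℝ) - t) / N * (N * x) := by
            gcongr; exact min_le_right _ _
        _ = _ := by field_simp
  have h3 : min 1 ((s + N) * x) / 4 ≤ x * ∑ j ∈ Finset.range t, (1 - x) ^ (2 * j) := by
    have g1 := half_one_sub_pow_le_geom hx1 t
    have g2 := half_min_one_mul_le_one_sub_pow hx0.le hx1 (2 * t)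
    have : min 1 ((s + N) * x) ≤ min 1 (((2 * t : ℕ) : ℝ) * x) := by
      gcongr
      have : s + N ≤ 2 * t := by omega
      exact_mod_cast this
    linarith
  calc _ = ((s + N : ℝ) - t) / N * min 1 (N * x) / 2 * (min 1 ((s + N) * x) / 4) := by
        field_simp; ring
    _ ≤ _ := by
        refine mul_le_mul h1 h3 (by positivity) (weight_lower hx0.le hx1 ht).1

theorem signal_sum_lower {x x1 : ℝ} (hx0 : 0 < x) (hx1 : x1 < 1) (hxx : x ≤ x1) (s N : ℕ)
    (hN : 2 ≤ N) (hn : (s + N) * x ≤ 1) :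
    x ^ 2 * Real.exp (-2) * min (1 / x1) (2 * s + N) / 8 * ((N : ℝ) ^ 2 - 1) / 8 ≤
      ∑ t ∈ Finset.Ico s (s + N), (1 - (1 - x) ^ (s + N - t)) *
        (x * ∑ j ∈ Finset.range t, (1 - x) ^ (2 * (t - 1 - j)) * (1 - x1) ^ (2 * j)) := by
  have hr : 0 ≤ 1 - x := by linarith
  have hq : 0 ≤ 1 - x1 := by linarith
  have hx1' : 0 < x1 := by linarith
  have hxl : x ≤ 1 := by linarith
  have hA : ∀ t : ℕ,
      0 ≤ x * ∑ j ∈ Finset.range t, (1 - x) ^ (2 * (t - 1 - j)) * (1 - x1) ^ (2 * j) := fun t =>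
    mul_nonneg hx0.le (Finset.sum_nonneg fun j _ => mul_nonneg (pow_nonneg hr _) (pow_nonneg hq _))
  have hm1 : 0 ≤ min (1 / x1) (2 * s + N) := le_min (by positivity) (by positivity)
  refine le_sum_Ico_of_half (fun t ht => mul_nonneg (weight_lower hx0.le hxl ht).1 (hA t))
    (by positivity) fun t ht h2 => ?_
  have ht' := Finset.mem_Ico.1 ht
  have hd0 : (0 : ℝ) ≤ (s + N : ℝ) - t := by
    have : ((t : ℕ) : ℝ) ≤ ((s + N : ℕ) : ℝ) := by exact_mod_cast ht'.2.le
    push_cast at this; linarith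
  have h1 : ((s + N : ℝ) - t) * x / 2 ≤ 1 - (1 - x) ^ (s + N - t) := by
    have := (weight_lower hx0.le hxl ht).2
    rwa [min_eq_right] at this
    refine le_trans ?_ hn
    gcongr
    have : (0 : ℝ) ≤ t := by positivity
    linarith
  -- Below the `k†` threshold the decay `(1 - x)` has not acted over the whole run, so it costs only
  -- `exp (-2)`; what remains is the decay in the top direction.
  have h3 : Real.exp (-2) * ∑ j ∈ Finset.range t, (1 - x1) ^ (2 * j) ≤
      ∑ j ∈ Finset.range t, (1 - x) ^ (2 * (t - 1 - j)) * (1 - x1) ^ (2 * j) := by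
    rw [Finset.mul_sum]
    refine Finset.sum_le_sum fun j hj => ?_
    refine mul_le_mul_of_nonneg_right ?_ (pow_nonneg hq _)
    refine exp_neg_two_le_pow (n := s + N) (by omega) hx0.le (by push_cast; exact hn) (by omega)
  have h4 : min (1 / x1) (2 * s + N) / 4 ≤ ∑ j ∈ Finset.range t, (1 - x1) ^ (2 * j) := by
    have g1 := half_one_sub_pow_le_geom hx1.le t
    have g2 := half_min_one_mul_le_one_sub_pow hx1'.le hx1.le (2 * t)
    have : x1 * min (1 / x1) (2 * s + N) ≤ min 1 (((2 * t : ℕ) : ℝ) * x1) := by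
      refine le_min ?_ ?_
      · calc _ ≤ x1 * (1 / x1) := by gcongr; exact min_le_left _ _
          _ = 1 := by field_simp
      · rw [mul_comm]
        gcongr
        refine (min_le_right _ _).trans ?_
        exact_mod_cast h2
    have h5 : x1 * (min (1 / x1) (2 * s + N) / 4) ≤
        x1 * ∑ j ∈ Finset.range t, (1 - x1) ^ (2 * j) := by linarith
    exact le_of_mul_le_mul_left h5 hx1'
  calc _ = ((s + N : ℝ) - t) * x / 2 *
        (x * (Real.exp (-2) * (min (1 / x1) (2 * s + N) / 4))) := by ring
    _ ≤ _ := by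
        refine mul_le_mul h1 ?_ (by positivity) (weight_lower hx0.le hxl ht).1
        refine mul_le_mul_of_nonneg_left (le_trans ?_ h3) hx0.le
        gcongr

theorem signal_sum_nonneg {x x1 : ℝ} (hx0 : 0 ≤ x) (hx1 : x1 ≤ 1) (hxl : x ≤ 1) (s N : ℕ) :
    0 ≤ ∑ t ∈ Finset.Ico s (s + N), (1 - (1 - x) ^ (s + N - t)) *
        (x * ∑ j ∈ Finset.range t, (1 - x) ^ (2 * (t - 1 - j)) * (1 - x1) ^ (2 * j)) := by
  refine Finset.sum_nonneg fun t ht => mul_nonneg (weight_lower hx0 hxl ht).1 <|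
    mul_nonneg hx0 <| Finset.sum_nonneg fun j _ => mul_nonneg (pow_nonneg ?_ _) (pow_nonneg ?_ _) <;>
  linarith

/-! ### The bound in a single eigendirection -/

/-- Summing over `k` first, `γl ∑_{k ≥ t} (1 - γl)^(k-t)` telescopes to the nonnegative weight `1 -
(1 - γl)^(s+N-t)`. The unrolled recursion can then be inserted termwise. -/
theorem weighted_sum_lower {a : ℕ → ℝ} {γ l l1 β σ h0 : ℝ} (s N : ℕ) (hγ : 0 < γ)
    (hl : 0 < l) (hll : l ≤ l1) (hl1 : γ * l1 < 1)
    (hrec : ∀ t, (1 - γ * l) ^ 2 * a t +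
      γ ^ 2 * l * (β * ((1 - γ * l1) ^ (2 * t) * h0) + σ) ≤ a (t + 1)) :
    a 0 * ∑ t ∈ Finset.Ico s (s + N), (1 - (1 - γ * l) ^ (s + N - t)) * (1 - γ * l) ^ (2 * t) +
      γ * β * h0 * ∑ t ∈ Finset.Ico s (s + N), (1 - (1 - γ * l) ^ (s + N - t)) *
        (γ * l * ∑ j ∈ Finset.range t, (1 - γ * l) ^ (2 * (t - 1 - j)) * (1 - γ * l1) ^ (2 * j)) +
      γ * σ * ∑ t ∈ Finset.Ico s (s + N), (1 - (1 - γ * l) ^ (s + N - t)) *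
        (γ * l * ∑ j ∈ Finset.range t, (1 - γ * l) ^ (2 * j)) ≤
    γ * l * ∑ t ∈ Finset.Ico s (s + N), ∑ k ∈ Finset.Ico t (s + N), (1 - γ * l) ^ (k - t) * a t := by
  have hx0 : 0 < γ * l := by positivity
  have hxl : γ * l ≤ 1 := by nlinarith
  have hw : γ * l * ∑ t ∈ Finset.Ico s (s + N), ∑ k ∈ Finset.Ico t (s + N),
      (1 - γ * l) ^ (k - t) * a t =
      ∑ t ∈ Finset.Ico s (s + N), (1 - (1 - γ * l) ^ (s + N - t)) * a t := by
    rw [Finset.mul_sum]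
    refine Finset.sum_congr rfl fun t ht => ?_
    rw [← Finset.sum_mul, Finset.sum_Ico_eq_sum_range, ← mul_assoc]
    simp only [Nat.add_sub_cancel_left]
    have := geom_sum_mul_neg (1 - γ * l) (s + N - t)
    rw [← this]; ring
  rw [hw, Finset.mul_sum, Finset.mul_sum, Finset.mul_sum, ← Finset.sum_add_distrib,
    ← Finset.sum_add_distrib]
  refine Finset.sum_le_sum fun t ht => ?_
  have h := le_of_linear_recursion (sq_nonneg (1 - γ * l)) hrec t
  have hrefl := Finset.sum_range_reflect (fun j => (1 - γ * l) ^ (2 * j)) t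
  have e : ((1 - γ * l) ^ 2) ^ t * a 0 + ∑ j ∈ Finset.range t, ((1 - γ * l) ^ 2) ^ (t - 1 - j) *
        (γ ^ 2 * l * (β * ((1 - γ * l1) ^ (2 * j) * h0) + σ)) =
      a 0 * (1 - γ * l) ^ (2 * t) + γ * β * h0 *
        (γ * l * ∑ j ∈ Finset.range t, (1 - γ * l) ^ (2 * (t - 1 - j)) * (1 - γ * l1) ^ (2 * j)) +
      γ * σ * (γ * l * ∑ j ∈ Finset.range t, (1 - γ * l) ^ (2 * j)) := by
    rw [← hrefl]
    simp only [Finset.mul_sum, ← pow_mul]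
    rw [add_assoc, ← Finset.sum_add_distrib]
    congr 1
    · ring
    · refine Finset.sum_congr rfl fun j _ => ?_
      ring
  rw [e] at h
  refine le_trans (le_of_eq ?_) (mul_le_mul_of_nonneg_left h (weight_lower hx0.le hxl ht).1)
  ring

theorem coordinate_lower {a : ℕ → ℝ} {γ l l1 β σ h0 : ℝ} (s N : ℕ) (hN : 500 ≤ N) (hγ : 0 < γ)
    (hl : 0 < l) (hll : l ≤ l1) (hl1 : γ * l1 < 1) (hβ : 0 ≤ β) (hσ : 0 ≤ σ) (hh : 0 ≤ h0)
    (ha0 : 0 ≤ a 0)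
    (hrec : ∀ t, (1 - γ * l) ^ 2 * a t +
      γ ^ 2 * l * (β * ((1 - γ * l1) ^ (2 * t) * h0) + σ) ≤ a (t + 1)) :
    (if 1 / (N * γ) ≤ l then 1 / (16 * γ ^ 2 * N ^ 2) * ((1 - γ * l) ^ (2 * s) * a 0 / l)
        else 1 / 16 * (l * ((1 - γ * l) ^ (2 * s) * a 0))) +
      (if 1 / ((s + N) * γ) ≤ l then 0 else
        β * γ * h0 / (128 * Real.exp 1 ^ 3) * min (1 / l1) ((2 * s + N) * γ) * l ^ 2) +
      σ / 600 * (if 1 / (N * γ) ≤ l then 1 / (N : ℝ) else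
        if 1 / ((s + N) * γ) ≤ l then γ * l else (s + N) * γ ^ 2 * l ^ 2) ≤
    1 / 2 * (l * ((N : ℝ)⁻¹ ^ 2 * ∑ t ∈ Finset.Ico s (s + N), ∑ k ∈ Finset.Ico t (s + N),
      (1 - γ * l) ^ (k - t) * a t)) := by
  have hN500 : (500 : ℝ) ≤ N := by exact_mod_cast hN
  have hN' : (0 : ℝ) < N := by linarith
  have hs0 : (0 : ℝ) ≤ s := by positivity
  have hl1' : 0 < l1 := by linarith
  have hx0 : 0 < γ * l := by positivity
  have hxx : γ * l ≤ γ * l1 := by gcongr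
  have hxl : γ * l ≤ 1 := by linarith
  -- The constant is `1 - 1/500²`; `N ≥ 500` is needed to absorb the `-1` here.
  have hNsq : (249999 : ℝ) / 250000 * N ^ 2 ≤ (N : ℝ) ^ 2 - 1 := by nlinarith
  have hmain := weighted_sum_lower s N hγ hl hll hl1 hrec
  have c1 : 1 / (N * γ) ≤ l ↔ 1 ≤ N * (γ * l) := by
    rw [div_le_iff₀ (by positivity)]; constructor <;> intro h <;> linarith
  have c2 : 1 / ((s + N) * γ) ≤ l ↔ 1 ≤ (s + N) * (γ * l) := by
    rw [div_le_iff₀ (by positivity)]; constructor <;> intro h <;> linarith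
  simp only [c1, c2]
  have hb := sq_one_sub_pow_le_sum (r := 1 - γ * l) (by linarith) (by linarith) s N
  have hb' := half_min_one_mul_le_one_sub_pow hx0.le hxl N
  have hn := noise_sum_lower hx0 hxl s N (by omega)
  have hsn := signal_sum_nonneg hx0.le hl1.le hxl s N
  have hs := signal_sum_lower hx0 hl1 hxx s N (by omega)
  have hmx : min (1 / l1) ((2 * s + N) * γ) = γ * min (1 / (γ * l1)) (2 * s + N) := by
    rw [mul_min_of_nonneg _ _ hγ.le]
    congr 1
    · field_simp
    · ring
  rw [hmx]
  generalize ∑ t ∈ Finset.Ico s (s + N), (1 - (1 - γ * l) ^ (s + N - t)) *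
    (1 - γ * l) ^ (2 * t) = S1 at *
  generalize ∑ t ∈ Finset.Ico s (s + N), (1 - (1 - γ * l) ^ (s + N - t)) *
        (γ * l * ∑ j ∈ Finset.range t, (1 - γ * l) ^ (2 * (t - 1 - j)) * (1 - γ * l1) ^ (2 * j))
    = S2 at *
  generalize ∑ t ∈ Finset.Ico s (s + N), (1 - (1 - γ * l) ^ (s + N - t)) *
        (γ * l * ∑ j ∈ Finset.range t, (1 - γ * l) ^ (2 * j)) = S3 at *
  generalize ∑ t ∈ Finset.Ico s (s + N), ∑ k ∈ Finset.Ico t (s + N),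
      (1 - γ * l) ^ (k - t) * a t = T at *
  have hB0 : 0 ≤ (1 - γ * l) ^ (2 * s) := pow_nonneg (by linarith) _
  generalize (1 - γ * l) ^ (2 * s) = B at *
  have hμ : 0 ≤ min (1 / (γ * l1)) (2 * s + N) := le_min (by positivity) (by positivity)
  generalize min (1 / (γ * l1)) (2 * (s : ℝ) + N) = μ at *
  have hNγ : 0 < 2 * γ * (N : ℝ) ^ 2 := by positivity
  have b1 : (if 1 ≤ N * (γ * l) then 1 / (16 * γ ^ 2 * N ^ 2) * (B * a 0 / l)
        else 1 / 16 * (l * (B * a 0))) ≤ a 0 * S1 / (2 * γ * N ^ 2) := by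
    have hS1 : B * (min 1 (N * (γ * l)) / 2) ^ 2 ≤ 2 * (γ * l) * S1 := by
      refine le_trans ?_ (hb.trans (le_of_eq (by ring)))
      gcongr
    have hS1' : B * (min 1 (N * (γ * l)) / 2) ^ 2 / (2 * (γ * l)) ≤ S1 := by
      rw [div_le_iff₀ (by positivity)]; linarith
    have : a 0 * (B * (min 1 (N * (γ * l)) / 2) ^ 2 / (2 * (γ * l))) / (2 * γ * N ^ 2) ≤
        a 0 * S1 / (2 * γ * N ^ 2) := by gcongr
    refine le_trans (le_of_eq ?_) this
    split_ifs with h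
    · rw [min_eq_left h]; field_simp; ring
    · rw [min_eq_right (not_le.1 h).le]; field_simp; ring
  have b2 : (if 1 ≤ (s + N) * (γ * l) then 0 else
        β * γ * h0 / (128 * Real.exp 1 ^ 3) * (γ * μ) * l ^ 2) ≤
        γ * β * h0 * S2 / (2 * γ * N ^ 2) := by
    split_ifs with h
    · positivity
    · have hs' := hs (not_le.1 h).le
      -- The honest constant is `exp (-2) (1 - 1/N²) / 128` with `128 = 8 · 8 · 2`; weakening `exp
      -- (-2)` to `exp (-3)` pays for the factor.
      have he : (1 : ℝ) / Real.exp 1 ^ 3 ≤ Real.exp (-2) * (249999 / 250000) := by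
        have e2 : Real.exp (-2) = 1 / Real.exp 1 ^ 2 := by
          rw [Real.exp_neg, ← Real.exp_nat_mul, one_div]; norm_num
        rw [e2, div_mul_eq_mul_div, div_le_div_iff₀ (by positivity) (by positivity)]
        have := Real.add_one_le_exp (1 : ℝ)
        have h2 : 0 < Real.exp 1 ^ 2 := by positivity
        nlinarith
      calc β * γ * h0 / (128 * Real.exp 1 ^ 3) * (γ * μ) * l ^ 2
          = β * γ ^ 2 * h0 * μ * l ^ 2 / 128 * (1 / Real.exp 1 ^ 3) := by field_simp
        _ ≤ β * γ ^ 2 * h0 * μ * l ^ 2 / 128 * (Real.exp (-2) * (249999 / 250000)) := by gcongr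
        _ = γ * β * h0 * ((γ * l) ^ 2 * Real.exp (-2) * μ / 8 * (249999 / 250000 * N ^ 2) / 8) /
              (2 * γ * N ^ 2) := by field_simp; ring
        _ ≤ γ * β * h0 * ((γ * l) ^ 2 * Real.exp (-2) * μ / 8 * ((N : ℝ) ^ 2 - 1) / 8) /
              (2 * γ * N ^ 2) := by gcongr
        _ ≤ γ * β * h0 * S2 / (2 * γ * N ^ 2) := by gcongr
  have b3 : σ / 600 * (if 1 ≤ N * (γ * l) then 1 / (N : ℝ) else
        if 1 ≤ (s + N) * (γ * l) then γ * l else (s + N) * γ ^ 2 * l ^ 2) ≤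
        γ * σ * S3 / (2 * γ * N ^ 2) := by
    -- The three regimes of the variance are one product of two truncations.
    have e : (if 1 ≤ N * (γ * l) then 1 / (N : ℝ) else
        if 1 ≤ (s + N) * (γ * l) then γ * l else (s + N) * γ ^ 2 * l ^ 2) =
        min 1 (N * (γ * l)) * min 1 ((s + N) * (γ * l)) / N := by
      split_ifs with h h'
      · rw [min_eq_left h, min_eq_left (by nlinarith)]; simp
      · rw [min_eq_right (not_le.1 h).le, min_eq_left h']; field_simp
      · rw [min_eq_right (not_le.1 h).le, min_eq_right (not_le.1 h').le]; field_simp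
    rw [e]
    have hm : 0 ≤ min 1 (N * (γ * l)) * min 1 ((s + N) * (γ * l)) :=
      mul_nonneg (le_min zero_le_one (by positivity)) (le_min zero_le_one (by positivity))
    generalize min 1 (N * (γ * l)) * min 1 ((s + N) * (γ * l)) = m at *
    calc σ / 600 * (m / N) ≤ σ / 128 * (249999 / 250000) * (m / N) := by
          have : 0 ≤ σ * (m / N) := by positivity
          linarith
      _ = γ * σ * (m / (8 * N) * (249999 / 250000 * N ^ 2) / 8) / (2 * γ * N ^ 2) := by
          field_simp; ring
      _ ≤ γ * σ * (m / (8 * N) * ((N : ℝ) ^ 2 - 1) / 8) / (2 * γ * N ^ 2) := by gcongr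
      _ ≤ γ * σ * S3 / (2 * γ * N ^ 2) := by gcongr
  calc _ ≤ a 0 * S1 / (2 * γ * N ^ 2) + γ * β * h0 * S2 / (2 * γ * N ^ 2) +
        γ * σ * S3 / (2 * γ * N ^ 2) := add_le_add (add_le_add b1 b2) b3
    _ = (a 0 * S1 + γ * β * h0 * S2 + γ * σ * S3) / (2 * γ * N ^ 2) := by ring
    _ ≤ γ * l * T / (2 * γ * N ^ 2) := by gcongr
    _ = _ := by field_simp

/-! ### Moments of one example and of one step -/

theorem opTrace_comp_rankOne {E : Type*} [NormedAddCommGroup E] [InnerProductSpace ℝ E]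
    [CompleteSpace E] (T : E →L[ℝ] E) (g : E) :
    opTrace (T ∘L rankOne ℝ g g) = inner ℝ g (T g) := by
  unfold opTrace
  rw [← (exists_hilbertBasis ℝ E).choose_spec.choose.tsum_inner_mul_inner g (T g)]
  refine tsum_congr fun i => ?_
  simp [inner_smul_right]

theorem abs_inner_mul_inner_le {E : Type*} [NormedAddCommGroup E] [InnerProductSpace ℝ E]
    (u g x : E) :
    |inner ℝ u x * inner ℝ g x| ≤ ‖u‖ * ‖g‖ * ‖x‖ ^ 2 := by
  rw [abs_mul]
  calc _ ≤ (‖u‖ * ‖x‖) * (‖g‖ * ‖x‖) := by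
        gcongr <;> exact abs_real_inner_le_norm _ _
    _ = _ := by ring

theorem continuous_rankOne_self {E : Type*} [NormedAddCommGroup E] [InnerProductSpace ℝ E] :
    Continuous fun x : E => rankOne ℝ x x :=
  (rankOne ℝ).continuous.clm_apply continuous_id

section Moments

variable {E : Type*} [NormedAddCommGroup E] [InnerProductSpace ℝ E] [CompleteSpace E]
  [SecondCountableTopology E] [MeasurableSpace E] [BorelSpace E]
  {D : Measure (E × ℝ)} [IsProbabilityMeasure D] {wstar : E} {σsq : ℝ≥0}

theorem integrable_of_bound_sq (h2 : Integrable (fun z : E × ℝ => ‖z.1‖ ^ 2) D) {f : E → ℝ}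
    (hf : Continuous f) {c : ℝ} (hb : ∀ x, |f x| ≤ c * ‖x‖ ^ 2) :
    Integrable (fun z : E × ℝ => f z.1) D :=
  (h2.const_mul c).mono' (by fun_prop) (Filter.Eventually.of_forall fun z => hb z.1)

theorem integrable_of_bound_four (h4 : Integrable (fun z : E × ℝ => ‖z.1‖ ^ 4) D) {f : E → ℝ}
    (hf : Continuous f) {c : ℝ} (hb : ∀ x, |f x| ≤ c * (1 + ‖x‖ ^ 4)) :
    Integrable (fun z : E × ℝ => f z.1) D :=
  (((integrable_const (1 : ℝ)).add h4).const_mul c).mono' (by fun_prop)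
    (Filter.Eventually.of_forall fun z => hb z.1)

theorem inner_secondMoment (h2 : Integrable (fun z : E × ℝ => ‖z.1‖ ^ 2) D) (u w : E) :
    inner ℝ u (secondMoment D w) = ∫ z, inner ℝ u z.1 * inner ℝ w z.1 ∂D := by
  have hI : Integrable (fun z : E × ℝ => rankOne ℝ z.1 z.1) D := by
    -- The operator space need not be separable; strong measurability comes from separability of the
    -- domain.
    have : SecondCountableTopologyEither (E × ℝ) (E →L[ℝ] E) := ⟨Or.inl inferInstance⟩
    refine h2.mono' (Continuous.aestronglyMeasurable ?_) (Filter.Eventually.of_forall fun z => ?_)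
    · exact continuous_rankOne_self.comp continuous_fst
    · rw [norm_rankOne, sq]
  have h1 : secondMoment D w = ∫ z : E × ℝ, rankOne ℝ z.1 z.1 w ∂D :=
    ContinuousLinearMap.integral_apply hI w
  rw [h1, ← integral_inner (hI.apply_continuousLinearMap w)]
  refine integral_congr_ae (Filter.Eventually.of_forall fun z => ?_)
  simp only [rankOne_apply, inner_smul_right, real_inner_comm w z.1]
  ring

theorem inner_fourthMoment_rankOne (h4 : Integrable (fun z : E × ℝ => ‖z.1‖ ^ 4) D) (g u : E) :
    inner ℝ u (fourthMoment D (rankOne ℝ g g) u) =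
      ∫ z, inner ℝ u z.1 ^ 2 * inner ℝ g z.1 ^ 2 ∂D := by
  have hI : Integrable
      (fun z : E × ℝ => rankOne ℝ z.1 z.1 ∘L rankOne ℝ g g ∘L rankOne ℝ z.1 z.1) D := by
    have : SecondCountableTopologyEither (E × ℝ) (E →L[ℝ] E) := ⟨Or.inl inferInstance⟩
    refine (h4.const_mul (‖g‖ ^ 2)).mono' (Continuous.aestronglyMeasurable ?_)
      (Filter.Eventually.of_forall fun z => ?_)
    · have hr := (continuous_rankOne_self (E := E)).comp (continuous_fst (Y := ℝ))
      exact hr.clm_comp (continuous_const.clm_comp hr)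
    · calc _ ≤ ‖rankOne ℝ z.1 z.1‖ * (‖rankOne ℝ g g‖ * ‖rankOne ℝ z.1 z.1‖) :=
            (ContinuousLinearMap.opNorm_comp_le _ _).trans <| by
              gcongr; exact ContinuousLinearMap.opNorm_comp_le _ _
        _ = _ := by simp only [norm_rankOne]; ring
  have h1 : fourthMoment D (rankOne ℝ g g) u =
      ∫ z : E × ℝ, (rankOne ℝ z.1 z.1 ∘L rankOne ℝ g g ∘L rankOne ℝ z.1 z.1) u ∂D :=
    ContinuousLinearMap.integral_apply hI u
  rw [h1, ← integral_inner (hI.apply_continuousLinearMap u)]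
  refine integral_congr_ae (Filter.Eventually.of_forall fun z => ?_)
  simp only [ContinuousLinearMap.comp_apply, rankOne_apply, inner_smul_right, map_smul,
    real_inner_comm u z.1, real_inner_comm g z.1]
  ring

theorem secondMoment_symm (h2 : Integrable (fun z : E × ℝ => ‖z.1‖ ^ 2) D) (u w : E) :
    inner ℝ u (secondMoment D w) = inner ℝ (secondMoment D u) w := by
  rw [real_inner_comm w, inner_secondMoment h2, inner_secondMoment h2]
  simp only [mul_comm]

theorem secondMoment_nonneg (h2 : Integrable (fun z : E × ℝ => ‖z.1‖ ^ 2) D) (w : E) :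
    0 ≤ inner ℝ w (secondMoment D w) := by
  rw [inner_secondMoment h2]
  exact integral_nonneg fun z => mul_self_nonneg _

/-- The hypothesis tested on `A = g gᵀ`, for which `tr(HA) = ⟨g, Hg⟩` and `⟨u, HAHu⟩ = ⟨u, Hg⟩²`.
Freezing `g` makes any recursion for operator-valued covariances unnecessary. -/
theorem fourth_moment_ge {β : ℝ} (h2 : Integrable (fun z : E × ℝ => ‖z.1‖ ^ 2) D)
    (h4 : Integrable (fun z : E × ℝ => ‖z.1‖ ^ 4) D) (hlower : FourthMomentLower D β) (g u : E) :
    inner ℝ u (secondMoment D g) ^ 2 +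
        β * inner ℝ g (secondMoment D g) * inner ℝ u (secondMoment D u) ≤
      ∫ z, inner ℝ u z.1 ^ 2 * inner ℝ g z.1 ^ 2 ∂D := by
  have h := (ContinuousLinearMap.le_def _ _).1 (hlower.2 _ (isPositive_rankOne_self g))
  have h' := h.inner_nonneg_right u
  rw [opTrace_comp_rankOne] at h'
  simp only [sub_apply, inner_sub_right, inner_fourthMoment_rankOne h4,
    smul_apply, inner_smul_right, ContinuousLinearMap.comp_apply,
    rankOne_apply, map_smul] at h'
  rw [secondMoment_symm h2 g u, real_inner_comm] at h'
  nlinarith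

/-- All that is used of the Gaussian law: square integrability, mean zero and variance. -/
theorem integral_noise (hwell : WellSpecified D wstar σsq) :
    Integrable (fun z : E × ℝ => z.2 - inner ℝ wstar z.1) D ∧
    Integrable (fun z : E × ℝ => (z.2 - inner ℝ wstar z.1) ^ 2) D ∧
    ∫ z, (z.2 - inner ℝ wstar z.1) ∂D = 0 ∧
    ∫ z, (z.2 - inner ℝ wstar z.1) ^ 2 ∂D = σsq := by
  have hm : Measurable (fun z : E × ℝ => z.2 - inner ℝ wstar z.1) := by fun_prop
  have hL : MemLp (id : ℝ → ℝ) 2 (gaussianReal 0 σsq) := memLp_id_gaussianReal 2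
  have hL' := hL
  rw [← hwell.noise_law] at hL'
  have hL2 : MemLp (fun z : E × ℝ => z.2 - inner ℝ wstar z.1) 2 D :=
    (memLp_map_measure_iff aestronglyMeasurable_id hm.aemeasurable).1 hL'
  refine ⟨hL2.integrable (by norm_num), hL2.integrable_sq, ?_, ?_⟩
  · have := integral_id_gaussianReal (μ := 0) (v := σsq)
    rw [← hwell.noise_law, integral_map hm.aemeasurable (by fun_prop)] at this
    exact this
  · have h3 := variance_id_gaussianReal (μ := 0) (v := σsq)
    rw [variance_eq_sub hL] at h3
    have h0 := integral_id_gaussianReal (μ := 0) (v := σsq)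
    simp only [id_eq, h0, Pi.pow_apply] at h3
    rw [← hwell.noise_law, integral_map hm.aemeasurable (by fun_prop)] at h3
    simpa using h3

theorem integrable_noise_mul (hwell : WellSpecified D wstar σsq) {f : E → ℝ} (hf : Continuous f)
    (hi : Integrable (fun z : E × ℝ => f z.1) D) :
    Integrable (fun z : E × ℝ => (z.2 - inner ℝ wstar z.1) * f z.1) D ∧
    ∫ z, (z.2 - inner ℝ wstar z.1) * f z.1 ∂D = 0 := by
  obtain ⟨hn, -, h0, -⟩ := integral_noise hwell
  have hind : IndepFun (fun z : E × ℝ => z.2 - inner ℝ wstar z.1) (fun z : E × ℝ => f z.1) D :=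
    hwell.indep.symm.comp measurable_id hf.measurable
  refine ⟨hind.integrable_mul hn hi, ?_⟩
  rw [hind.integral_fun_mul_eq_mul_integral hn.aestronglyMeasurable hi.aestronglyMeasurable, h0,
    zero_mul]

theorem integrable_noise_sq_mul (hwell : WellSpecified D wstar σsq) {f : E → ℝ}
    (hf : Continuous f) (hi : Integrable (fun z : E × ℝ => f z.1) D) :
    Integrable (fun z : E × ℝ => (z.2 - inner ℝ wstar z.1) ^ 2 * f z.1) D ∧
    ∫ z, (z.2 - inner ℝ wstar z.1) ^ 2 * f z.1 ∂D = σsq * ∫ z, f z.1 ∂D := by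
  obtain ⟨-, hn, -, h0⟩ := integral_noise hwell
  have hind : IndepFun (fun z : E × ℝ => (z.2 - inner ℝ wstar z.1) ^ 2)
      (fun z : E × ℝ => f z.1) D :=
    hwell.indep.symm.comp (φ := fun x => x ^ 2) (measurable_id.pow_const 2) hf.measurable
  refine ⟨hind.integrable_mul hn hi, ?_⟩
  rw [hind.integral_fun_mul_eq_mul_integral hn.aestronglyMeasurable hi.aestronglyMeasurable, h0]

theorem integral_combination {f1 f2 f3 f4 : E × ℝ → ℝ} (c c1 c2 c3 c4 : ℝ)
    (h1 : Integrable f1 D) (h2 : Integrable f2 D) (h3 : Integrable f3 D) (h4 : Integrable f4 D) :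
    ∫ z, (c + c1 * f1 z + c2 * f2 z + c3 * f3 z + c4 * f4 z) ∂D =
      c + c1 * ∫ z, f1 z ∂D + c2 * ∫ z, f2 z ∂D + c3 * ∫ z, f3 z ∂D + c4 * ∫ z, f4 z ∂D := by
  have i0 : Integrable (fun _ : E × ℝ => c) D := integrable_const c
  have i1 : Integrable (fun z => c + c1 * f1 z) D := i0.add (h1.const_mul c1)
  have i2 : Integrable (fun z => c + c1 * f1 z + c2 * f2 z) D := i1.add (h2.const_mul c2)
  have i3 : Integrable (fun z => c + c1 * f1 z + c2 * f2 z + c3 * f3 z) D :=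
    i2.add (h3.const_mul c3)
  rw [integral_add i3 (h4.const_mul c4), integral_add i2 (h3.const_mul c3),
    integral_add i1 (h2.const_mul c2), integral_add i0 (h1.const_mul c1)]
  simp only [integral_const_mul]
  simp

theorem risk_eq (hreg : RegularMoments D wstar) (hwell : WellSpecified D wstar σsq) (w : E) :
    risk D w = 1 / 2 * (σsq + inner ℝ (w - wstar) (secondMoment D (w - wstar))) := by
  set g := w - wstar with hg
  have hgx : Integrable (fun z : E × ℝ => inner ℝ g z.1) D :=
    integrable_of_bound_four hreg.integrable_x_four (f := fun x => inner ℝ g x) (by fun_prop)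
      (c := ‖g‖) fun x => by
        refine (abs_real_inner_le_norm _ _).trans ?_
        gcongr
        nlinarith [sq_nonneg (‖x‖ ^ 2 - 1), sq_nonneg (‖x‖ - 1), sq_nonneg (‖x‖)]
  have hgg : Integrable (fun z : E × ℝ => inner ℝ g z.1 * inner ℝ g z.1) D :=
    integrable_of_bound_sq hreg.integrable_x_sq (f := fun x => inner ℝ g x * inner ℝ g x)
      (by fun_prop) (abs_inner_mul_inner_le g g)
  obtain ⟨-, hn2, -, hn2'⟩ := integral_noise hwell
  obtain ⟨hc, hc'⟩ := integrable_noise_mul hwell (f := fun x => inner ℝ g x) (by fun_prop) hgx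
  unfold risk
  congr 1
  -- Padded with zero coefficients to the shape of `integral_combination`.
  have e : ∀ z : E × ℝ, (z.2 - inner ℝ w z.1) ^ 2 = 0 + 1 * (z.2 - inner ℝ wstar z.1) ^ 2 +
      (-2) * ((z.2 - inner ℝ wstar z.1) * inner ℝ g z.1) +
      1 * (inner ℝ g z.1 * inner ℝ g z.1) + 0 * (inner ℝ g z.1 * inner ℝ g z.1) := by
    intro z
    have : inner ℝ w z.1 = inner ℝ wstar z.1 + inner ℝ g z.1 := by
      rw [← inner_add_left, hg]; simp
    rw [this]; ring
  rw [integral_congr_ae (Filter.Eventually.of_forall e), integral_combination _ _ _ _ _ hn2 hc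
    hgg hgg, hc', hn2', inner_secondMoment hreg.integrable_x_sq]
  ring

theorem integral_step (hreg : RegularMoments D wstar) (hwell : WellSpecified D wstar σsq)
    (γ : ℝ) (g u : E) :
    ∫ z, inner ℝ u (g + (γ * ((z.2 - inner ℝ wstar z.1) - inner ℝ g z.1)) • z.1) ∂D =
      inner ℝ u g - γ * inner ℝ u (secondMoment D g) := by
  have hux : Integrable (fun z : E × ℝ => inner ℝ u z.1) D :=
    integrable_of_bound_four hreg.integrable_x_four (f := fun x => inner ℝ u x) (by fun_prop)
      (c := ‖u‖) fun x => by
        refine (abs_real_inner_le_norm _ _).trans ?_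
        gcongr
        nlinarith [sq_nonneg (‖x‖ ^ 2 - 1), sq_nonneg (‖x‖ - 1), sq_nonneg (‖x‖)]
  have hug : Integrable (fun z : E × ℝ => inner ℝ u z.1 * inner ℝ g z.1) D :=
    integrable_of_bound_sq hreg.integrable_x_sq (f := fun x => inner ℝ u x * inner ℝ g x)
      (by fun_prop) (abs_inner_mul_inner_le u g)
  obtain ⟨hc, hc'⟩ := integrable_noise_mul hwell (f := fun x => inner ℝ u x) (by fun_prop) hux
  have e : ∀ z : E × ℝ,
      inner ℝ u (g + (γ * ((z.2 - inner ℝ wstar z.1) - inner ℝ g z.1)) • z.1) =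
      inner ℝ u g + γ * ((z.2 - inner ℝ wstar z.1) * inner ℝ u z.1) +
        (-γ) * (inner ℝ u z.1 * inner ℝ g z.1) + 0 * inner ℝ u z.1 + 0 * inner ℝ u z.1 := by
    intro z
    rw [inner_add_right, inner_smul_right]; ring
  rw [integral_congr_ae (Filter.Eventually.of_forall e), integral_combination _ _ _ _ _ hc hug
    hux hux, hc', inner_secondMoment hreg.integrable_x_sq]
  ring

/-- Terms linear in the noise vanish by independence. In the rest, the `⟨u, Hg⟩²` from `HAH` is
exactly what completes the square of the mean step, leaving the `β` term and the label noise as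
excess variance. -/
theorem integral_step_sq_ge {β : ℝ} (hreg : RegularMoments D wstar)
    (hwell : WellSpecified D wstar σsq) (hlower : FourthMomentLower D β) (γ : ℝ) (g u : E) :
    (inner ℝ u g - γ * inner ℝ u (secondMoment D g)) ^ 2 +
        γ ^ 2 * inner ℝ u (secondMoment D u) * (β * inner ℝ g (secondMoment D g) + σsq) ≤
      ∫ z, inner ℝ u (g + (γ * ((z.2 - inner ℝ wstar z.1) - inner ℝ g z.1)) • z.1) ^ 2 ∂D := by
  have hux : Integrable (fun z : E × ℝ => inner ℝ u z.1) D :=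
    integrable_of_bound_four hreg.integrable_x_four (f := fun x => inner ℝ u x) (by fun_prop)
      (c := ‖u‖) fun x => by
        refine (abs_real_inner_le_norm _ _).trans ?_
        gcongr
        nlinarith [sq_nonneg (‖x‖ ^ 2 - 1), sq_nonneg (‖x‖ - 1), sq_nonneg (‖x‖)]
  have hug : Integrable (fun z : E × ℝ => inner ℝ u z.1 * inner ℝ g z.1) D :=
    integrable_of_bound_sq hreg.integrable_x_sq (f := fun x => inner ℝ u x * inner ℝ g x)
      (by fun_prop) (abs_inner_mul_inner_le u g)
  have huu : Integrable (fun z : E × ℝ => inner ℝ u z.1 * inner ℝ u z.1) D :=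
    integrable_of_bound_sq hreg.integrable_x_sq (f := fun x => inner ℝ u x * inner ℝ u x)
      (by fun_prop) (abs_inner_mul_inner_le u u)
  have h4 : Integrable (fun z : E × ℝ => inner ℝ u z.1 ^ 2 * inner ℝ g z.1 ^ 2) D :=
    integrable_of_bound_four hreg.integrable_x_four
      (f := fun x => inner ℝ u x ^ 2 * inner ℝ g x ^ 2) (by fun_prop) (c := (‖u‖ * ‖g‖) ^ 2)
      fun x => by
        have := abs_inner_mul_inner_le u g x
        calc |inner ℝ u x ^ 2 * inner ℝ g x ^ 2| = |inner ℝ u x * inner ℝ g x| ^ 2 := by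
              rw [← mul_pow, abs_pow]
          _ ≤ (‖u‖ * ‖g‖ * ‖x‖ ^ 2) ^ 2 := by gcongr
          _ = (‖u‖ * ‖g‖) ^ 2 * ‖x‖ ^ 4 := by ring
          _ ≤ _ := by gcongr; linarith
  have h3 : Integrable (fun z : E × ℝ => inner ℝ u z.1 * (inner ℝ u z.1 * inner ℝ g z.1)) D :=
    integrable_of_bound_four hreg.integrable_x_four
      (f := fun x => inner ℝ u x * (inner ℝ u x * inner ℝ g x)) (by fun_prop)
      (c := ‖u‖ ^ 2 * ‖g‖) fun x => by
        rw [abs_mul]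
        calc _ ≤ (‖u‖ * ‖x‖) * (‖u‖ * ‖g‖ * ‖x‖ ^ 2) := by
              gcongr
              · exact abs_real_inner_le_norm _ _
              · exact abs_inner_mul_inner_le u g x
          _ = ‖u‖ ^ 2 * ‖g‖ * ‖x‖ ^ 3 := by ring
          _ ≤ _ := by
            gcongr
            have := norm_nonneg x
            nlinarith [sq_nonneg (‖x‖ ^ 2 - 1), sq_nonneg (‖x‖ - 1), sq_nonneg (‖x‖),
              mul_nonneg (sq_nonneg ‖x‖) (sq_nonneg (‖x‖ - 1))]
  obtain ⟨hc, hc'⟩ := integrable_noise_mul hwell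
    (f := fun x => 2 * inner ℝ u g * γ * inner ℝ u x -
      2 * γ ^ 2 * (inner ℝ u x * (inner ℝ u x * inner ℝ g x))) (by fun_prop)
    ((hux.const_mul _).sub (h3.const_mul _))
  obtain ⟨hq, hq'⟩ := integrable_noise_sq_mul hwell (f := fun x => inner ℝ u x * inner ℝ u x)
    (by fun_prop) huu
  have e : ∀ z : E × ℝ,
      inner ℝ u (g + (γ * ((z.2 - inner ℝ wstar z.1) - inner ℝ g z.1)) • z.1) ^ 2 =
      inner ℝ u g ^ 2 + 1 * ((z.2 - inner ℝ wstar z.1) * (2 * inner ℝ u g * γ * inner ℝ u z.1 -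
      2 * γ ^ 2 * (inner ℝ u z.1 * (inner ℝ u z.1 * inner ℝ g z.1)))) +
        (-(2 * γ * inner ℝ u g)) * (inner ℝ u z.1 * inner ℝ g z.1) +
        γ ^ 2 * ((z.2 - inner ℝ wstar z.1) ^ 2 * (inner ℝ u z.1 * inner ℝ u z.1)) +
        γ ^ 2 * (inner ℝ u z.1 ^ 2 * inner ℝ g z.1 ^ 2) := by
    intro z
    rw [inner_add_right, inner_smul_right]; ring
  have hge := fourth_moment_ge hreg.integrable_x_sq hreg.integrable_x_four hlower g u
  rw [integral_congr_ae (Filter.Eventually.of_forall e), integral_combination _ _ _ _ _ hc hug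
    hq h4, hc', hq', ← inner_secondMoment hreg.integrable_x_sq,
    ← inner_secondMoment hreg.integrable_x_sq]
  have := mul_le_mul_of_nonneg_left hge (sq_nonneg γ)
  linarith

end Moments

/-! ### Independence, and second moments of the iterates -/

theorem integral_indep {Ω F G : Type*} [MeasurableSpace Ω] [MeasurableSpace F] [MeasurableSpace G]
    {P : Measure Ω} [IsProbabilityMeasure P] {X : Ω → F} {Z : Ω → G} (hX : Measurable X)
    (hZ : Measurable Z) (hind : IndepFun X Z P) {f : F × G → ℝ} (hf : Measurable f)
    (hi : Integrable (fun ω => f (X ω, Z ω)) P) :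
    ∫ ω, f (X ω, Z ω) ∂P = ∫ ω, ∫ z, f (X ω, z) ∂(P.map Z) ∂P ∧
      Integrable (fun ω => ∫ z, f (X ω, z) ∂(P.map Z)) P := by
  have hpair : Measurable fun ω => (X ω, Z ω) := hX.prodMk hZ
  have : IsProbabilityMeasure (P.map Z) := Measure.isProbabilityMeasure_map hZ.aemeasurable
  have : IsProbabilityMeasure (P.map X) := Measure.isProbabilityMeasure_map hX.aemeasurable
  have hmap := hind.map_prod_eq_prod_map_map hX.aemeasurable hZ.aemeasurable
  have hi' : Integrable f ((P.map X).prod (P.map Z)) := by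
    rw [← hmap, integrable_map_measure hf.aestronglyMeasurable hpair.aemeasurable]
    exact hi
  have hl := hi'.integral_prod_left
  refine ⟨?_, (integrable_map_measure hl.aestronglyMeasurable hX.aemeasurable).1 hl⟩
  rw [← integral_map (f := f) hpair.aemeasurable hf.aestronglyMeasurable, hmap,
    integral_prod _ hi', integral_map hX.aemeasurable hl.aestronglyMeasurable]

section Iterates

variable {E : Type*} [NormedAddCommGroup E] [InnerProductSpace ℝ E] [CompleteSpace E]
  [SecondCountableTopology E] [MeasurableSpace E] [BorelSpace E]

theorem measurable_sgd {Ω : Type*} [MeasurableSpace Ω] (γ : ℝ) (w0 : E) {z : ℕ → Ω → E × ℝ}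
    (hz : ∀ t, Measurable (z t)) (t : ℕ) : Measurable fun ω => sgd γ w0 (fun t => z t ω) t := by
  induction t with
  | zero => exact measurable_const
  | succ t ih =>
    simp only [sgd]
    have h1 := (hz t).fst
    have h2 := (hz t).snd
    exact ih.add (((h2.sub (ih.inner h1)).const_mul γ).smul h1)

theorem sgd_congr {γ : ℝ} {w0 : E} {z z' : ℕ → E × ℝ} {t : ℕ} (h : ∀ i < t, z i = z' i) :
    sgd γ w0 z t = sgd γ w0 z' t := by
  induction t with
  | zero => rfl
  | succ t ih =>
    simp only [sgd]
    rw [ih fun i hi => h i (hi.trans t.lt_succ_self), h t t.lt_succ_self]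

variable {D : Measure (E × ℝ)} [IsProbabilityMeasure D] {wstar w0 : E} {σsq : ℝ≥0} {β γ : ℝ}
  {Ω : Type*} [MeasurableSpace Ω] {P : Measure Ω} [IsProbabilityMeasure P] {z : ℕ → Ω → E × ℝ}

/-- Iterates up to index `k` depend only on examples with index below `k`. The pair is needed for
correlations between different times. -/
theorem indepFun_sgd (hz : IsIIDSample P D z) {t k : ℕ} (htk : t ≤ k) :
    IndepFun (fun ω => (sgd γ w0 (fun t => z t ω) t - wstar, sgd γ w0 (fun t => z t ω) k - wstar))
      (z k) P := by
  have h := hz.indep.indepFun_finset (Finset.range k) {k} (by simp) hz.measurable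
  -- Extends the first `k` examples by zeros to a full sequence; by `sgd_congr` the filler is never
  -- read.
  let F : ℕ → ((Finset.range k) → E × ℝ) → E × ℝ :=
    fun n p => if h : n ∈ Finset.range k then p ⟨n, h⟩ else 0
  have hF : ∀ n, Measurable (F n) := by
    intro n
    by_cases hn : n ∈ Finset.range k
    · simp only [F, hn, dif_pos]; exact measurable_pi_apply _
    · simp only [F, hn, dif_neg, not_false_eq_true]; exact measurable_const
  let ψ : (({k} : Finset ℕ) → E × ℝ) → E × ℝ := fun p => p ⟨k, Finset.mem_singleton_self k⟩
  have hψ : Measurable ψ := measurable_pi_apply _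
  have h' := h.comp
    (φ := fun p => (sgd γ w0 (fun n => F n p) t - wstar, sgd γ w0 (fun n => F n p) k - wstar))
    (ψ := ψ)
    (((measurable_sgd γ w0 hF t).sub_const _).prodMk ((measurable_sgd γ w0 hF k).sub_const _))
    hψ
  convert h' using 1
  funext ω
  simp only [Function.comp]
  rw [sgd_congr (z' := fun n => F n fun i => z i ω) (t := t),
    sgd_congr (z' := fun n => F n fun i => z i ω) (t := k)]
  · intro i hi
    simp [F, hi]
  · intro i hi
    simp [F, hi.trans_le htk]
  · rfl

theorem indepFun_sgd_self (hz : IsIIDSample P D z) (k : ℕ) :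
    IndepFun (fun ω => sgd γ w0 (fun t => z t ω) k - wstar) (z k) P :=
  (indepFun_sgd hz le_rfl).comp measurable_snd measurable_id

theorem sgd_succ_sub (z : ℕ → E × ℝ) (t : ℕ) :
    sgd γ w0 z (t + 1) - wstar = (sgd γ w0 z t - wstar) +
      (γ * (((z t).2 - inner ℝ wstar (z t).1) - inner ℝ (sgd γ w0 z t - wstar) (z t).1)) •
        (z t).1 := by
  have : (z t).2 - inner ℝ wstar (z t).1 - inner ℝ (sgd γ w0 z t - wstar) (z t).1 =
      (z t).2 - inner ℝ (sgd γ w0 z t) (z t).1 := by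
    rw [inner_sub_left]; ring
  rw [this]
  simp only [sgd]
  abel

theorem integrable_comp_sample (hz : IsIIDSample P D z) (k : ℕ) {f : E × ℝ → ℝ}
    (hf : Integrable f D) : Integrable (fun ω => f (z k ω)) P := by
  rw [← hz.law k] at hf
  exact (integrable_map_measure hf.aestronglyMeasurable (hz.measurable k).aemeasurable).1 hf

theorem memLp_sgd (hreg : RegularMoments D wstar) (hwell : WellSpecified D wstar σsq)
    (hz : IsIIDSample P D z) (t : ℕ) :
    MemLp (fun ω => sgd γ w0 (fun t => z t ω) t - wstar) 2 P := by
  induction t with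
  | zero => exact memLp_const (w0 - wstar)
  | succ t ih =>
    have hm := (measurable_sgd γ w0 hz.measurable t).sub_const wstar
    have hzt := hz.measurable t
    have h1 : Measurable fun ω => (z t ω).1 := hzt.fst
    have h2 : Measurable fun ω => (z t ω).2 := hzt.snd
    have a1 : MemLp (fun ω => ((z t ω).2 - inner ℝ wstar (z t ω).1) • (z t ω).1) 2 P := by
      rw [memLp_two_iff_integrable_sq_norm]
      · refine (integrable_comp_sample hz t (integrable_noise_sq_mul hwell
          (f := fun x => ‖x‖ ^ 2) (by fun_prop) hreg.integrable_x_sq).1).congr ?_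
        refine Filter.Eventually.of_forall fun ω => ?_
        simp only [norm_smul, mul_pow, Real.norm_eq_abs, sq_abs]
      · exact ((h2.sub (h1.const_inner)).smul h1).aestronglyMeasurable
    have a2 : MemLp (fun ω =>
        (inner ℝ (sgd γ w0 (fun t => z t ω) t - wstar) (z t ω).1) • (z t ω).1) 2 P := by
      have hmeas : Measurable fun ω =>
        (inner ℝ (sgd γ w0 (fun t => z t ω) t - wstar) (z t ω).1) • (z t ω).1 :=
          (hm.inner h1).smul h1
      rw [memLp_two_iff_integrable_sq_norm hmeas.aestronglyMeasurable]
      -- The squared norm is at most `‖g‖² ‖x‖⁴`, a product of independent integrable variables;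
      -- hence the fourth moment assumption.
      have hi1 : Integrable (fun ω => ‖sgd γ w0 (fun t => z t ω) t - wstar‖ ^ 2) P :=
        (memLp_two_iff_integrable_sq_norm hm.aestronglyMeasurable).1 ih
      have hi2 : Integrable (fun ω => ‖(z t ω).1‖ ^ 4) P :=
        integrable_comp_sample hz t hreg.integrable_x_four
      have hind : IndepFun (fun ω => ‖sgd γ w0 (fun t => z t ω) t - wstar‖ ^ 2)
          (fun ω => ‖(z t ω).1‖ ^ 4) P :=
        (indepFun_sgd_self hz t).comp (φ := fun g : E => ‖g‖ ^ 2) (ψ := fun z : E × ℝ => ‖z.1‖ ^ 4)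
          (by fun_prop) (by fun_prop)
      refine (hind.integrable_mul hi1 hi2).mono' (hmeas.norm.pow_const 2).aestronglyMeasurable ?_
      refine Filter.Eventually.of_forall fun ω => ?_
      simp only [norm_smul, Pi.mul_apply, norm_pow, norm_mul, norm_norm]
      have := norm_inner_le_norm (𝕜 := ℝ) (sgd γ w0 (fun t => z t ω) t - wstar) (z t ω).1
      calc _ ≤ (‖sgd γ w0 (fun t => z t ω) t - wstar‖ * ‖(z t ω).1‖ * ‖(z t ω).1‖) ^ 2 := by
            gcongr
        _ = _ := by ring
    refine ((ih.add (a1.const_smul γ)).sub (a2.const_smul γ)).ae_eq ?_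
    refine Filter.Eventually.of_forall fun ω => ?_
    simp only [Pi.add_apply, Pi.sub_apply, Pi.smul_apply]
    rw [sgd_succ_sub]
    module

theorem integrable_inner_mul_inner {g h : Ω → E} (hg : MemLp g 2 P) (hh : MemLp h 2 P) (u v : E) :
    Integrable (fun ω => inner ℝ u (g ω) * inner ℝ v (h ω)) P :=
  (hg.const_inner u).integrable_mul (hh.const_inner v)

theorem integrable_quadratic {g : Ω → E} (hg : MemLp g 2 P) (T : E →L[ℝ] E) :
    Integrable (fun ω => inner ℝ (g ω) (T (g ω))) P := by
  have h := (memLp_two_iff_integrable_sq_norm hg.aestronglyMeasurable).1 hg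
  refine (h.const_mul ‖T‖).mono' ?_ (Filter.Eventually.of_forall fun ω => ?_)
  · exact hg.aestronglyMeasurable.inner (T.continuous.comp_aestronglyMeasurable
      hg.aestronglyMeasurable)
  · calc _ ≤ ‖g ω‖ * ‖T (g ω)‖ := norm_inner_le_norm _ _
      _ ≤ ‖g ω‖ * (‖T‖ * ‖g ω‖) := by gcongr; exact T.le_opNorm _
      _ = _ := by ring

theorem integral_inner_sgd_mul_succ (hreg : RegularMoments D wstar)
    (hwell : WellSpecified D wstar σsq) (hz : IsIIDSample P D z) {u : E} {l : ℝ}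
    (hu : secondMoment D u = l • u) {t k : ℕ} (htk : t ≤ k) :
    ∫ ω, inner ℝ u (sgd γ w0 (fun t => z t ω) t - wstar) *
        inner ℝ u (sgd γ w0 (fun t => z t ω) (k + 1) - wstar) ∂P =
      (1 - γ * l) * ∫ ω, inner ℝ u (sgd γ w0 (fun t => z t ω) t - wstar) *
        inner ℝ u (sgd γ w0 (fun t => z t ω) k - wstar) ∂P := by
  let f : (E × E) × (E × ℝ) → ℝ := fun p => inner ℝ u p.1.1 *
    inner ℝ u (p.1.2 + (γ * ((p.2.2 - inner ℝ wstar p.2.1) - inner ℝ p.1.2 p.2.1)) • p.2.1)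
  have hf : Measurable f := by fun_prop
  have hm := fun t => (measurable_sgd γ w0 hz.measurable t).sub_const wstar
  have e : ∀ ω, inner ℝ u (sgd γ w0 (fun t => z t ω) t - wstar) *
        inner ℝ u (sgd γ w0 (fun t => z t ω) (k + 1) - wstar) =
      f ((sgd γ w0 (fun t => z t ω) t - wstar, sgd γ w0 (fun t => z t ω) k - wstar), z k ω) := by
    intro ω
    simp only [f]
    rw [sgd_succ_sub]
  have hi := integrable_inner_mul_inner (memLp_sgd (γ := γ) (w0 := w0) hreg hwell hz t)
    (memLp_sgd (γ := γ) (w0 := w0) hreg hwell hz (k + 1)) u u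
  simp only [e] at hi ⊢
  rw [(integral_indep ((hm t).prodMk (hm k)) (hz.measurable k) (indepFun_sgd hz htk) hf hi).1,
    hz.law k, ← integral_const_mul]
  refine integral_congr_ae (Filter.Eventually.of_forall fun ω => ?_)
  simp only [f]
  rw [integral_const_mul, integral_step hreg hwell, secondMoment_symm hreg.integrable_x_sq, hu,
    inner_smul_left]
  simp only [RCLike.conj_to_real]
  ring

theorem integral_inner_sgd_mul (hreg : RegularMoments D wstar)
    (hwell : WellSpecified D wstar σsq) (hz : IsIIDSample P D z) {u : E} {l : ℝ}
    (hu : secondMoment D u = l • u) {t k : ℕ} (htk : t ≤ k) :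
    ∫ ω, inner ℝ u (sgd γ w0 (fun t => z t ω) t - wstar) *
        inner ℝ u (sgd γ w0 (fun t => z t ω) k - wstar) ∂P =
      (1 - γ * l) ^ (k - t) * ∫ ω, inner ℝ u (sgd γ w0 (fun t => z t ω) t - wstar) ^ 2 ∂P := by
  induction k, htk using Nat.le_induction with
  | base => simp [sq]
  | succ k htk ih =>
    rw [integral_inner_sgd_mul_succ hreg hwell hz hu htk, ih, Nat.succ_sub htk, pow_succ]
    ring

theorem integral_inner_sgd_succ_sq_ge (hreg : RegularMoments D wstar)
    (hwell : WellSpecified D wstar σsq) (hlower : FourthMomentLower D β)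
    (hz : IsIIDSample P D z) {u : E} {l : ℝ} (hu1 : ‖u‖ = 1)
    (hu : secondMoment D u = l • u) (t : ℕ) :
    (1 - γ * l) ^ 2 * ∫ ω, inner ℝ u (sgd γ w0 (fun t => z t ω) t - wstar) ^ 2 ∂P +
        γ ^ 2 * l * (β * ∫ ω, inner ℝ (sgd γ w0 (fun t => z t ω) t - wstar)
          (secondMoment D (sgd γ w0 (fun t => z t ω) t - wstar)) ∂P + σsq) ≤
      ∫ ω, inner ℝ u (sgd γ w0 (fun t => z t ω) (t + 1) - wstar) ^ 2 ∂P := by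
  let f : E × (E × ℝ) → ℝ := fun p =>
    inner ℝ u (p.1 + (γ * ((p.2.2 - inner ℝ wstar p.2.1) - inner ℝ p.1 p.2.1)) • p.2.1) ^ 2
  have hf : Measurable f := by fun_prop
  have hm := (measurable_sgd γ w0 hz.measurable t).sub_const wstar
  have e : ∀ ω, inner ℝ u (sgd γ w0 (fun t => z t ω) (t + 1) - wstar) ^ 2 =
      f (sgd γ w0 (fun t => z t ω) t - wstar, z t ω) := by
    intro ω
    simp only [f]
    rw [sgd_succ_sub]
  have hL := memLp_sgd (γ := γ) (w0 := w0) hreg hwell hz t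
  have hi := integrable_inner_mul_inner (memLp_sgd (γ := γ) (w0 := w0) hreg hwell hz (t + 1))
    (memLp_sgd (γ := γ) (w0 := w0) hreg hwell hz (t + 1)) u u
  simp only [← sq, e] at hi ⊢
  obtain ⟨h1, h2⟩ := integral_indep hm (hz.measurable t) (indepFun_sgd_self hz t) hf hi
  rw [h1]
  rw [hz.law t] at h2 ⊢
  have j1 : Integrable (fun ω => (1 - γ * l) ^ 2 *
      inner ℝ u (sgd γ w0 (fun t => z t ω) t - wstar) ^ 2) P := by
    simp only [sq (inner ℝ u _)]
    exact (integrable_inner_mul_inner hL hL u u).const_mul _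
  have j2 := integrable_quadratic hL (secondMoment D)
  have j3 : Integrable (fun ω => γ ^ 2 * l * (β * inner ℝ (sgd γ w0 (fun t => z t ω) t - wstar)
          (secondMoment D (sgd γ w0 (fun t => z t ω) t - wstar)) + σsq)) P :=
    ((j2.const_mul β).add (integrable_const _)).const_mul _
  have e2 : (1 - γ * l) ^ 2 * ∫ ω, inner ℝ u (sgd γ w0 (fun t => z t ω) t - wstar) ^ 2 ∂P +
        γ ^ 2 * l * (β * ∫ ω, inner ℝ (sgd γ w0 (fun t => z t ω) t - wstar)
          (secondMoment D (sgd γ w0 (fun t => z t ω) t - wstar)) ∂P + σsq) =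
      ∫ ω, ((1 - γ * l) ^ 2 * inner ℝ u (sgd γ w0 (fun t => z t ω) t - wstar) ^ 2 +
        γ ^ 2 * l * (β * inner ℝ (sgd γ w0 (fun t => z t ω) t - wstar)
          (secondMoment D (sgd γ w0 (fun t => z t ω) t - wstar)) + σsq)) ∂P := by
    rw [integral_add j1 j3, integral_const_mul, integral_const_mul,
      integral_add (j2.const_mul β) (integrable_const _), integral_const_mul]
    simp
  rw [e2]
  refine integral_mono (j1.add j3) h2 fun ω => ?_
  have h := integral_step_sq_ge hreg hwell hlower γ (sgd γ w0 (fun t => z t ω) t - wstar) u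
  refine le_trans (le_of_eq ?_) h
  rw [secondMoment_symm hreg.integrable_x_sq u, hu, inner_smul_left, inner_smul_right,
    real_inner_self_eq_norm_sq, hu1]
  simp only [RCLike.conj_to_real]
  ring

end Iterates

/-! ### Series over the eigenbasis -/

namespace SortedEigendecomposition

variable {E : Type*} [NormedAddCommGroup E] [InnerProductSpace ℝ E] [CompleteSpace E]
  {T : E →L[ℝ] E} (e : SortedEigendecomposition T)

/-- The index set of the eigenbasis. -/
abbrev Index : Type := {i : ℕ // 1 ≤ i ∧ (i : ℕ∞) ≤ e.dim}

theorem inner_v_apply (hT : ∀ u w, inner ℝ u (T w) = inner ℝ (T u) w)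
    (i : e.Index) (w : E) :
    inner ℝ (e.v i) (T w) = e.lam i * inner ℝ (e.v i) w := by
  rw [hT, e.apply_v, inner_smul_left]; simp

theorem inner_v_one_sub_pow (hT : ∀ u w, inner ℝ u (T w) = inner ℝ (T u) w)
    (i : e.Index) (γ : ℝ) (s : ℕ) (w : E) :
    inner ℝ (e.v i) (((1 - γ • T) ^ s) w) = (1 - γ * e.lam i) ^ s * inner ℝ (e.v i) w := by
  induction s with
  | zero => simp
  | succ s ih =>
    rw [pow_succ', ContinuousLinearMap.mul_def, ContinuousLinearMap.comp_apply, sub_apply,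
      smul_apply, inner_sub_right, inner_smul_right, e.inner_v_apply hT]
    simp only [one_apply_eq_self, ih]
    ring

theorem hasSum_quadratic (hT : ∀ u w, inner ℝ u (T w) = inner ℝ (T u) w) (w : E) :
    HasSum (fun i : e.Index => e.lam i * inner ℝ (e.v i) w ^ 2) (inner ℝ w (T w)) := by
  have h : (fun i : e.Index => e.lam i * inner ℝ (e.v i) w ^ 2) =
      fun i => inner ℝ w (e.v i) * inner ℝ (e.v i) (T w) := by
    funext i
    rw [e.inner_v_apply hT, real_inner_comm w]; ring
  rw [h]
  exact e.v.hasSum_inner_mul_inner w (T w)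

theorem hasSum_subtype {f : ℕ → ℝ} {a : ℝ}
    (h0 : ∀ i : ℕ, ¬(1 ≤ i ∧ (i : ℕ∞) ≤ e.dim) → f i = 0) :
    HasSum (fun i : e.Index => f i) a ↔ HasSum f a :=
  hasSum_subtype_iff_of_support_subset (s := {i : ℕ | 1 ≤ i ∧ (i : ℕ∞) ≤ e.dim})
    fun i hi => by_contra fun h => hi (h0 i h)

/-- Summability forces the eigenvalues to `0`, so the set under the supremum is bounded and the
natural-number `sSup` is a true maximum, or `0` when empty. Monotonicity makes the set an initial
segment. -/
theorem le_cutoff_iff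
    (hsum : Summable fun i : e.Index => e.lam i) {θ : ℝ}
    (hθ : 0 < θ) {k : ℕ} (hk : 1 ≤ k) : k ≤ e.cutoff θ ↔ θ ≤ e.lam k := by
  obtain ⟨a, ha⟩ := hsum
  -- Index `0` is masked because `lam 0` is unconstrained.
  have h1 : HasSum (fun i : ℕ => if 1 ≤ i then e.lam i else 0) a := by
    refine (e.hasSum_subtype fun i hi => ?_).1 ?_
    · split_ifs with h
      · exact e.lam_eq_zero i (not_le.1 fun h' => hi ⟨h, h'⟩)
      · rfl
    · convert ha using 2 with i
      rw [if_pos i.2.1]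
  have hbdd : BddAbove {k : ℕ | 1 ≤ k ∧ θ ≤ e.lam k} := by
    have := (h1.summable.tendsto_atTop_zero.eventually (gt_mem_nhds hθ))
    obtain ⟨n, hn⟩ := Filter.eventually_atTop.1 this
    refine ⟨n, fun k hk => le_of_not_gt fun hkn => ?_⟩
    have := hn k hkn.le
    rw [if_pos hk.1] at this
    linarith [hk.2]
  constructor
  · intro h
    have hne : {k : ℕ | 1 ≤ k ∧ θ ≤ e.lam k}.Nonempty := by
      by_contra hne
      rw [Set.not_nonempty_iff_eq_empty] at hne
      rw [cutoff, hne] at h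
      simp at h
      omega
    exact (Nat.sSup_mem hne hbdd).2.trans (e.lam_anti k _ hk h)
  · exact fun h => le_csSup hbdd ⟨hk, h⟩

theorem mem_index_of_lam_ne_zero {i : ℕ} (hi : 1 ≤ i) (h : e.lam i ≠ 0) :
    1 ≤ i ∧ (i : ℕ∞) ≤ e.dim :=
  ⟨hi, le_of_not_gt fun h' => h (e.lam_eq_zero i h')⟩

theorem hasSum_tailSumSq (hsum : Summable fun i : e.Index => e.lam i)
    (hpos : ∀ i : e.Index, 0 ≤ e.lam i) (k : ℕ) :
    HasSum (fun i : e.Index => if k < (i : ℕ) then e.lam i ^ 2 else 0)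
      (e.tailSumSq k) := by
  have hs : Summable fun i : e.Index =>
      if k < (i : ℕ) then e.lam i ^ 2 else 0 := by
    -- Domination by `λ_i² ≤ λ₁ λ_i`.
    refine Summable.of_nonneg_of_le (fun i => ?_) (fun i => ?_) (hsum.mul_left (e.lam 1))
    · split_ifs <;> positivity
    · have h1 := e.lam_anti 1 i le_rfl i.2.1
      have h2 := hpos i
      split_ifs
      · nlinarith
      · exact mul_nonneg (h2.trans h1) h2
  obtain ⟨a, ha⟩ := hs
  have h2 := (e.hasSum_subtype (f := fun i => if k < i then e.lam i ^ 2 else 0) fun i hi => by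
    split_ifs with h
    · by_contra h0
      exact hi (e.mem_index_of_lam_ne_zero (by omega) fun h' => h0 (by simp [h']))
    · rfl).1 ha
  rw [tailSumSq, h2.tsum_eq]
  exact ha

/-- Puts finite sums over ranks on the same index set as the other series: constant `f` counts `k*`,
and `f = lam` gives the middle block. Nonzero eigenvalues guarantee that these ranks do index basis
vectors. -/
theorem hasSum_Ioc (f : ℕ → ℝ) {a b : ℕ} (h : ∀ i, a < i → i ≤ b → e.lam i ≠ 0) :
    HasSum (fun i : e.Index =>
      if a < (i : ℕ) ∧ (i : ℕ) ≤ b then f i else 0) (∑ i ∈ Finset.Ioc a b, f i) := by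
  refine (e.hasSum_subtype (f := fun i => if a < i ∧ i ≤ b then f i else 0) fun i hi => ?_).2 ?_
  · rw [if_neg]
    rintro ⟨h1, h2⟩
    exact hi (e.mem_index_of_lam_ne_zero (by omega) (h i h1 h2))
  · rw [Finset.sum_congr rfl fun i hi => (if_pos (c := a < i ∧ i ≤ b) (t := f i) (e := 0)
      (Finset.mem_Ioc.1 hi)).symm]
    exact hasSum_sum_of_ne_finset_zero fun i hi => if_neg fun h => hi (Finset.mem_Ioc.2 h)

theorem hasSum_headInvNormSq (k : ℕ) (w : E) :
    HasSum (fun i : e.Index =>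
      if (i : ℕ) ≤ k then (inner ℝ (e.v i) w) ^ 2 / e.lam i else 0) (e.headInvNormSq k w) := by
  refine Summable.hasSum (summable_of_hasFiniteSupport ?_)
  refine Set.Finite.subset (Set.Finite.preimage Subtype.val_injective.injOn (Set.finite_Iic k)) ?_
  intro i hi
  by_contra h
  exact hi (if_neg h)

theorem hasSum_tailNormSq (hT : ∀ u w, inner ℝ u (T w) = inner ℝ (T u) w)
    (hpos : ∀ i : e.Index, 0 ≤ e.lam i) (k : ℕ) (w : E) :
    HasSum (fun i : e.Index =>
      if k < (i : ℕ) then e.lam i * (inner ℝ (e.v i) w) ^ 2 else 0) (e.tailNormSq k w) := by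
  refine Summable.hasSum (Summable.of_nonneg_of_le (fun i => ?_) (fun i => ?_)
    (e.hasSum_quadratic hT w).summable) <;>
  · have := mul_nonneg (hpos i) (sq_nonneg (inner ℝ (e.v i) w))
    split_ifs <;> simp [this]

end SortedEigendecomposition

/-! ### From coordinates to the quadratic form -/

section Final

variable {E : Type*} [NormedAddCommGroup E] [InnerProductSpace ℝ E] [CompleteSpace E]
  [SecondCountableTopology E] [MeasurableSpace E] [BorelSpace E]
  {D : Measure (E × ℝ)} [IsProbabilityMeasure D] {wstar w0 : E} {σsq : ℝ≥0} {β γ : ℝ}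
  {Ω : Type*} [MeasurableSpace Ω] {P : Measure Ω} [IsProbabilityMeasure P] {z : ℕ → Ω → E × ℝ}

theorem lam_pos (hreg : RegularMoments D wstar) (e : SortedEigendecomposition (secondMoment D))
    (i : e.Index) : 0 < e.lam i := by
  have h1 : ‖e.v i‖ = 1 := e.v.orthonormal.1 i
  have h := hreg.pos_def (e.v i) (by rintro h; simp [h] at h1)
  rw [e.apply_v, inner_smul_right, real_inner_self_eq_norm_sq, h1] at h
  simpa using h

theorem summable_lam (hreg : RegularMoments D wstar)
    (e : SortedEigendecomposition (secondMoment D)) :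
    Summable fun i : e.Index => e.lam i := by
  have hi : ∀ i : e.Index, Integrable (fun z : E × ℝ => inner ℝ (e.v i) z.1 * inner ℝ (e.v i) z.1) D :=
    fun i => integrable_of_bound_sq hreg.integrable_x_sq
      (f := fun x => inner ℝ (e.v i) x * inner ℝ (e.v i) x) (by fun_prop)
      (abs_inner_mul_inner_le (e.v i) (e.v i))
  refine summable_of_sum_le (c := ∫ z, ‖z.1‖ ^ 2 ∂D) (fun i => (lam_pos hreg e i).le) fun S => ?_
  have : ∀ i : e.Index, e.lam i = ∫ z, inner ℝ (e.v i) z.1 * inner ℝ (e.v i) z.1 ∂D := by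
    intro i
    rw [← inner_secondMoment hreg.integrable_x_sq, e.apply_v, inner_smul_right,
      real_inner_self_eq_norm_sq, e.v.orthonormal.1 i]
    simp
  simp only [this]
  rw [← integral_finsetSum _ fun i _ => hi i]
  refine integral_mono (integrable_finsetSum _ fun i _ => hi i) hreg.integrable_x_sq fun z => ?_
  -- Bessel's inequality, so the partial sums of `λ_i = E⟨v_i, x⟩²` stay below `E‖x‖²`.
  have := e.v.orthonormal.sum_inner_products_le z.1 (s := S)
  refine le_trans (le_of_eq ?_) this
  refine Finset.sum_congr rfl fun i _ => ?_
  rw [Real.norm_eq_abs, sq_abs, sq]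

/-- Finite sets of coordinates suffice for a lower bound, so sum and expectation are never
interchanged for an infinite series. -/
theorem sum_integral_le_integral_quadratic (hreg : RegularMoments D wstar)
    (e : SortedEigendecomposition (secondMoment D)) {g : Ω → E} (hg : MemLp g 2 P)
    (S : Finset e.Index) :
    ∑ i ∈ S, e.lam i * ∫ ω, inner ℝ (e.v i) (g ω) ^ 2 ∂P ≤
      ∫ ω, inner ℝ (g ω) (secondMoment D (g ω)) ∂P := by
  have hi : ∀ i : e.Index, Integrable (fun ω => e.lam i * inner ℝ (e.v i) (g ω) ^ 2) P := fun i => by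
    simp only [sq]
    exact (integrable_inner_mul_inner hg hg _ _).const_mul _
  simp only [← integral_const_mul]
  rw [← integral_finsetSum _ fun i _ => hi i]
  refine integral_mono (integrable_finsetSum _ fun i _ => hi i) (integrable_quadratic hg _)
    fun ω => ?_
  exact sum_le_hasSum S
    (fun i _ => mul_nonneg (lam_pos hreg e i).le (sq_nonneg _))
    (e.hasSum_quadratic (secondMoment_symm hreg.integrable_x_sq) (g ω))

/-- Each coordinate contracts by at most `(1 - γλ_i)²` per step once the nonnegative noise is
discarded, and `1 - γλ_i ≥ 1 - γλ₁ ≥ 0`. -/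
theorem integral_quadratic_sgd_ge (hreg : RegularMoments D wstar)
    (hwell : WellSpecified D wstar σsq) (hlower : FourthMomentLower D β)
    (hz : IsIIDSample P D z) (e : SortedEigendecomposition (secondMoment D)) (hγ : 0 < γ)
    (hγ1 : γ * e.lam 1 < 1) (t : ℕ) :
    (1 - γ * e.lam 1) ^ (2 * t) * inner ℝ (w0 - wstar) (secondMoment D (w0 - wstar)) ≤
      ∫ ω, inner ℝ (sgd γ w0 (fun t => z t ω) t - wstar)
          (secondMoment D (sgd γ w0 (fun t => z t ω) t - wstar)) ∂P := by
  have hs := (e.hasSum_quadratic (secondMoment_symm hreg.integrable_x_sq) (w0 - wstar)).mul_left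
    ((1 - γ * e.lam 1) ^ (2 * t))
  refine hasSum_le_of_sum_le hs fun S => ?_
  refine le_trans (Finset.sum_le_sum fun i _ => ?_)
    (sum_integral_le_integral_quadratic hreg e (memLp_sgd hreg hwell hz t) S)
  have hl := lam_pos hreg e i
  have hll := e.lam_anti 1 i le_rfl i.2.1
  have hrec : ∀ t, (1 - γ * e.lam i) ^ 2 *
      ∫ ω, inner ℝ (e.v i) (sgd γ w0 (fun t => z t ω) t - wstar) ^ 2 ∂P + 0 ≤
      ∫ ω, inner ℝ (e.v i) (sgd γ w0 (fun t => z t ω) (t + 1) - wstar) ^ 2 ∂P := by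
    intro t
    refine le_trans (add_le_add le_rfl ?_) (integral_inner_sgd_succ_sq_ge hreg hwell hlower hz
      (e.v.orthonormal.1 i) (e.apply_v i) t)
    have : 0 ≤ ∫ ω, inner ℝ (sgd γ w0 (fun t => z t ω) t - wstar)
          (secondMoment D (sgd γ w0 (fun t => z t ω) t - wstar)) ∂P :=
      integral_nonneg fun ω => secondMoment_nonneg hreg.integrable_x_sq _
    have := hlower.1
    positivity
  have h := le_of_linear_recursion (sq_nonneg _)
    (a := fun t => ∫ ω, inner ℝ (e.v i) (sgd γ w0 (fun t => z t ω) t - wstar) ^ 2 ∂P)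
    (c := fun _ => 0) hrec t
  simp only [mul_zero, Finset.sum_const_zero, add_zero, sgd, integral_const, probReal_univ,
    one_smul, ← pow_mul] at h
  calc _ = e.lam i * ((1 - γ * e.lam 1) ^ (2 * t) * inner ℝ (e.v i) (w0 - wstar) ^ 2) := by ring
    _ ≤ e.lam i * ((1 - γ * e.lam i) ^ (2 * t) * inner ℝ (e.v i) (w0 - wstar) ^ 2) := by
        gcongr
    _ ≤ _ := by gcongr

theorem tailAverage_sub (γ : ℝ) (w0 wstar : E) (s : ℕ) {N : ℕ} (hN : N ≠ 0) (z : ℕ → E × ℝ) :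
    tailAverage γ w0 s N z - wstar =
      (N : ℝ)⁻¹ • ∑ t ∈ Finset.Ico s (s + N), (sgd γ w0 z t - wstar) := by
  have : (N : ℝ) ≠ 0 := by exact_mod_cast hN
  rw [tailAverage, Finset.sum_sub_distrib, smul_sub]
  congr 1
  simp [← Nat.cast_smul_eq_nsmul ℝ, smul_smul, this]

theorem memLp_tailAverage (hreg : RegularMoments D wstar) (hwell : WellSpecified D wstar σsq)
    (hz : IsIIDSample P D z) (s : ℕ) {N : ℕ} (hN : N ≠ 0) :
    MemLp (fun ω => tailAverage γ w0 s N (fun t => z t ω) - wstar) 2 P := by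
  simp only [tailAverage_sub γ w0 wstar s hN]
  exact (memLp_finsetSum _ fun t _ => memLp_sgd hreg hwell hz t).const_smul _

theorem integral_inner_tailAverage_sq_ge (hreg : RegularMoments D wstar)
    (hwell : WellSpecified D wstar σsq) (hz : IsIIDSample P D z) {u : E} {l : ℝ}
    (hu : secondMoment D u = l • u) (hl : γ * l ≤ 1) (s : ℕ) {N : ℕ} (hN : N ≠ 0) :
    (N : ℝ)⁻¹ ^ 2 * ∑ t ∈ Finset.Ico s (s + N), ∑ k ∈ Finset.Ico t (s + N), (1 - γ * l) ^ (k - t) *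
        ∫ ω, inner ℝ u (sgd γ w0 (fun t => z t ω) t - wstar) ^ 2 ∂P ≤
      ∫ ω, inner ℝ u (tailAverage γ w0 s N (fun t => z t ω) - wstar) ^ 2 ∂P := by
  have hi : ∀ t k, Integrable (fun ω => inner ℝ u (sgd γ w0 (fun t => z t ω) t - wstar) *
      inner ℝ u (sgd γ w0 (fun t => z t ω) k - wstar)) P := fun t k =>
    integrable_inner_mul_inner (memLp_sgd hreg hwell hz t) (memLp_sgd hreg hwell hz k) u u
  have hnn : ∀ t, 0 ≤ ∫ ω, inner ℝ u (sgd γ w0 (fun t => z t ω) t - wstar) ^ 2 ∂P :=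
    fun t => integral_nonneg fun ω => sq_nonneg _
  have e : ∀ ω, inner ℝ u (tailAverage γ w0 s N (fun t => z t ω) - wstar) ^ 2 =
      (N : ℝ)⁻¹ ^ 2 * ∑ t ∈ Finset.Ico s (s + N), ∑ k ∈ Finset.Ico s (s + N),
        inner ℝ u (sgd γ w0 (fun t => z t ω) t - wstar) *
        inner ℝ u (sgd γ w0 (fun t => z t ω) k - wstar) := by
    intro ω
    rw [tailAverage_sub γ w0 wstar s hN, inner_smul_right, inner_sum, mul_pow,
      sq (Finset.sum _ _), Finset.sum_mul_sum]
  simp only [e]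
  rw [integral_const_mul, integral_finsetSum _ fun t _ => integrable_finsetSum _ fun k _ => hi t k]
  refine mul_le_mul_of_nonneg_left (Finset.sum_le_sum fun t ht => ?_) (by positivity)
  rw [integral_finsetSum _ fun k _ => hi t k]
  have ht' := Finset.mem_Ico.1 ht
  have hr : 0 ≤ 1 - γ * l := by linarith
  refine le_trans (Finset.sum_le_sum fun k hk => ?_) (Finset.sum_le_sum_of_subset_of_nonneg
    (Finset.Ico_subset_Ico_left ht'.1) fun k _ _ => ?_)
  · rw [integral_inner_sgd_mul hreg hwell hz hu (Finset.mem_Ico.1 hk).1]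
  · rcases le_total t k with h | h
    · rw [integral_inner_sgd_mul hreg hwell hz hu h]
      exact mul_nonneg (pow_nonneg hr _) (hnn t)
    · simp only [mul_comm (inner ℝ u (sgd γ w0 (fun t => z t _) t - wstar))]
      rw [integral_inner_sgd_mul hreg hwell hz hu h]
      exact mul_nonneg (pow_nonneg hr _) (hnn k)

end Final

end TailSGD

/-! ### The main theorem -/

theorem theorem5p2
    {E : Type*} [NormedAddCommGroup E] [InnerProductSpace ℝ E] [CompleteSpace E]
    [SecondCountableTopology E] [MeasurableSpace E] [BorelSpace E]
    (D : Measure (E × ℝ)) [IsProbabilityMeasure D]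
    (wstar w0 : E) (σsq : ℝ≥0) (β γ : ℝ) (s N : ℕ)
    (e : TailSGD.SortedEigendecomposition (TailSGD.secondMoment D))
    (hreg : TailSGD.RegularMoments D wstar)
    (hwell : TailSGD.WellSpecified D wstar σsq)
    (hupper : ∃ α : ℝ, TailSGD.FourthMomentUpper D α)
    (hlower : TailSGD.FourthMomentLower D β)
    (hN : 500 ≤ N) (hγ : 0 < γ) (hγ1 : γ < 1 / e.lam 1)
    {Ω : Type*} [MeasurableSpace Ω] (P : Measure Ω) [IsProbabilityMeasure P]
    (z : ℕ → Ω → E × ℝ) (hz : TailSGD.IsIIDSample P D z)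
    (kstar kdag : ℕ)
    (hkstar : kstar = e.cutoff (1 / (N * γ)))
    (hkdag : kdag = e.cutoff (1 / ((s + N) * γ))) :
    Integrable
      (fun ω => TailSGD.risk D (TailSGD.tailAverage γ w0 s N (fun t => z t ω))) P ∧
    1 / (16 * γ ^ 2 * N ^ 2) *
          e.headInvNormSq kstar (((1 - γ • TailSGD.secondMoment D) ^ s) (w0 - wstar)) +
        1 / 16 * e.tailNormSq kstar (((1 - γ • TailSGD.secondMoment D) ^ s) (w0 - wstar)) +
        β * γ * inner ℝ (w0 - wstar) (TailSGD.secondMoment D (w0 - wstar)) /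
            (128 * Real.exp 1 ^ 3) *
          min (1 / e.lam 1) ((2 * s + N) * γ) * e.tailSumSq kdag +
        (σsq : ℝ) / 600 *
          ((kstar : ℝ) / N + γ * ∑ i ∈ Finset.Ioc kstar kdag, e.lam i +
            (s + N) * γ ^ 2 * e.tailSumSq kdag) ≤
      (∫ ω, TailSGD.risk D (TailSGD.tailAverage γ w0 s N (fun t => z t ω)) ∂P) -
        TailSGD.risk D wstar := by
  have hNpos : (0 : ℝ) < N := by
    have : (500 : ℝ) ≤ N := by exact_mod_cast hN
    linarith
  have hN0 : N ≠ 0 := by omega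
  -- A positive stepsize below `1 / λ₁` already forces `λ₁ > 0`.
  have hl1 : 0 < e.lam 1 := one_div_pos.1 (hγ.trans hγ1)
  have hγl : γ * e.lam 1 < 1 := (lt_div_iff₀ hl1).1 hγ1
  have hT := TailSGD.secondMoment_symm hreg.integrable_x_sq
  have hpos := TailSGD.lam_pos hreg e
  have hsum := TailSGD.summable_lam hreg e
  have hL := TailSGD.memLp_tailAverage (γ := γ) (w0 := w0) hreg hwell hz s hN0
  have hquad := TailSGD.integrable_quadratic hL (TailSGD.secondMoment D)
  simp only [TailSGD.risk_eq hreg hwell]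
  refine ⟨((integrable_const _).add hquad).const_mul _, ?_⟩
  rw [integral_const_mul, integral_add (integrable_const _) hquad]
  simp only [integral_const, probReal_univ, one_smul, sub_self, map_zero, inner_zero_right,
    add_zero, mul_add, add_sub_cancel_left]
  have hθs : 0 < 1 / (N * γ) := by positivity
  have hθd : 0 < 1 / ((s + N) * γ) := by positivity
  have hθ : 1 / ((s + N) * γ) ≤ 1 / (N * γ) := by
    gcongr
    have : (0 : ℝ) ≤ s := by positivity
    linarith
  have cs : ∀ i, 1 ≤ i → (i ≤ kstar ↔ 1 / (N * γ) ≤ e.lam i) := fun i hi => by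
    rw [hkstar]; exact e.le_cutoff_iff hsum hθs hi
  have cd : ∀ i, 1 ≤ i → (i ≤ kdag ↔ 1 / ((s + N) * γ) ≤ e.lam i) := fun i hi => by
    rw [hkdag]; exact e.le_cutoff_iff hsum hθd hi
  have s1 := e.hasSum_headInvNormSq kstar (((1 - γ • TailSGD.secondMoment D) ^ s) (w0 - wstar))
  have s2 := e.hasSum_tailNormSq hT (fun i => (hpos i).le) kstar
    (((1 - γ • TailSGD.secondMoment D) ^ s) (w0 - wstar))
  have s3 := e.hasSum_tailSumSq hsum (fun i => (hpos i).le) kdag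
  have s4 := e.hasSum_Ioc (fun _ => (1 : ℝ)) (a := 0) (b := kstar)
    fun i h1 h2 => (hθs.trans_le ((cs i h1).1 h2)).ne'
  have s5 := e.hasSum_Ioc e.lam (a := kstar) (b := kdag)
    fun i h1 h2 => (hθd.trans_le ((cd i (by omega)).1 h2)).ne'
  simp only [Finset.sum_const, Nat.card_Ioc, tsub_zero, nsmul_eq_mul, mul_one] at s4
  -- The whole right-hand side as one series over the eigenbasis, so that it can be compared
  -- coordinate by coordinate on finite sets.
  have hall := (((s1.mul_left (1 / (16 * γ ^ 2 * (N : ℝ) ^ 2))).add (s2.mul_left (1 / 16))).add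
    (s3.mul_left (β * γ * inner ℝ (w0 - wstar) (TailSGD.secondMoment D (w0 - wstar)) /
            (128 * Real.exp 1 ^ 3) * min (1 / e.lam 1) ((2 * s + N) * γ)))).add
    ((((s4.div_const (N : ℝ)).add (s5.mul_left γ)).add
      (s3.mul_left ((s + N) * γ ^ 2))).mul_left ((σsq : ℝ) / 600))
  simp only [← mul_add]
  refine hasSum_le_of_sum_le hall fun S => ?_
  refine le_trans (Finset.sum_le_sum (g := fun i : e.Index => 1 / 2 * (e.lam i * ∫ ω, inner ℝ (e.v i)
    (TailSGD.tailAverage γ w0 s N (fun t => z t ω) - wstar) ^ 2 ∂P)) fun i _ => ?_) ?_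
  · have hl := hpos i
    have hll := e.lam_anti 1 i le_rfl i.2.1
    have hc := TailSGD.coordinate_lower
      (a := fun t => ∫ ω, inner ℝ (e.v i) (TailSGD.sgd γ w0 (fun t => z t ω) t - wstar) ^ 2 ∂P)
      s N hN hγ hl hll hγl hlower.1 σsq.2
      (TailSGD.secondMoment_nonneg hreg.integrable_x_sq (w0 - wstar))
      (integral_nonneg fun ω => sq_nonneg _) (fun t => by
        refine le_trans ?_ (TailSGD.integral_inner_sgd_succ_sq_ge hreg hwell hlower hz
          (e.v.orthonormal.1 i) (e.apply_v i) t)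
        have := TailSGD.integral_quadratic_sgd_ge (w0 := w0) hreg hwell hlower hz e hγ hγl t
        have := hlower.1
        gcongr
        exact le_rfl)
    have havg := TailSGD.integral_inner_tailAverage_sq_ge (γ := γ) (w0 := w0) hreg hwell hz
      (e.apply_v i) (by nlinarith) s hN0
    have hb : ∫ ω, inner ℝ (e.v i) (TailSGD.sgd γ w0 (fun t => z t ω) 0 - wstar) ^ 2 ∂P =
        inner ℝ (e.v i) (w0 - wstar) ^ 2 := by
      simp [TailSGD.sgd]
    simp only [hb] at hc
    refine le_trans (le_of_eq ?_) (hc.trans (by gcongr))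
    simp only [e.inner_v_one_sub_pow hT, ← cs i i.2.1, ← cd i i.2.1, mul_pow, ← pow_mul,
      mul_comm s 2]
    -- This leaves three cases, head, middle and tail, matching the branches in `coordinate_lower`.
    have hkk : (i : ℕ) ≤ kstar → (i : ℕ) ≤ kdag := fun h =>
      (cd i i.2.1).2 (hθ.trans ((cs i i.2.1).1 h))
    have hi1 := i.2.1
    by_cases h1 : (i : ℕ) ≤ kstar
    · have h2 := hkk h1
      simp [h1, h2, not_lt.2 h1, not_lt.2 h2, Nat.lt_of_lt_of_le Nat.zero_lt_one hi1]
    · by_cases h2 : (i : ℕ) ≤ kdag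
      · simp [h1, h2, not_le.1 h1, not_lt.2 h2]
      · simp [h1, h2, not_le.1 h1, not_le.1 h2]
  · rw [← Finset.mul_sum]
    gcongr
    exact TailSGD.sum_integral_le_integral_quadratic hreg e hL S
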